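/- For integers $k,g\ge 3$ and $d\ge 1$, a $(k;g,d)$-graph is a finite simple connected $k$-regular graph of girth $g$ and diameter $d$, and $n(k;g,d)$ denotes the smallest order of such a graph. For all integers $k,g\ge 3$ the number $n(k;g,d)$ is defined for all sufficiently large $d$, and there is a smallest real number $f(k,g)$ such that $n(k;g,d)\le f(k,g)\,d+O_{k,g}(1)$ as $d\to\infty$, where $O_{k,g}(1)$ denotes a constant depending only on $k$ and $g$. Theorem: for all integers $k,g\ge 3$, one can compute $f(k,g)$ in $O_{k,g}(1)$ time. That is, each $f(k,g)$ is a rational number, and there are a single algorithm (Turing machine) and a function $T:\mathbb N^2\to\mathbb N$ such that for all integers $k,g\ge 3$ the algorithm, on input $(k,g)$, halts after at most $T(k,g)$ steps and outputs $f(k,g)$ exactly, as a fraction of integers. -/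

import Mathlib

open Filter Turing

/-- A `(k;g,d)`-graph: a connected `k`-regular graph of girth `g` and diameter `d`. -/
structure IsGirthDiamGraph {V : Type} (G : SimpleGraph V) [G.LocallyFinite] (k g d : ℕ) :
    Prop where
  connected : G.Connected
  regular : G.IsRegularOfDegree k
  girth_eq : G.girth = g
  diam_eq : G.diam = d

/-- The set of all orders of finite `(k;g,d)`-graphs. -/
def girthDiamOrders (k g d : ℕ) : Set ℕ :=
  {n | ∃ (G : SimpleGraph (Fin n)) (_ : G.LocallyFinite), IsGirthDiamGraph G k g d}

/-- `n(k;g,d)`, the order of a `(k;g,d)`-cage, i.e. of a smallest `(k;g,d)`-graph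
(meaningful only if there is a `(k;g,d)`-graph). -/
noncomputable def girthDiamCageOrder (k g d : ℕ) : ℕ :=
  sInf (girthDiamOrders k g d)

/-- The real numbers `c` such that, as `d` goes to infinity, `n(k;g,d) ≤ c * d + O_{k,g}(1)`
(including that `n(k;g,d)` is defined, i.e. that `(k;g,d)`-graphs exist, for all large `d`). -/
def linearRates (k g : ℕ) : Set ℝ :=
  {c | ∃ C : ℝ, ∀ᶠ d : ℕ in atTop,
    (girthDiamOrders k g d).Nonempty ∧ (girthDiamCageOrder k g d : ℝ) ≤ c * d + C}

/-- `f(k,g)`, the smallest real number `c` with `n(k;g,d) ≤ c * d + O_{k,g}(1)` as `d → ∞`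
(that the infimum is a minimum is part of the theorem). -/
noncomputable def girthDiamRate (k g : ℕ) : ℝ :=
  sInf (linearRates k g)

/-- A pair of natural numbers as a word over the four-letter alphabet `PartrecToTM2.Γ'`: the binary
digits of `a` (least significant first), a separator, the binary digits of `b`, a separator. -/
def pairWord (a b : ℕ) : List PartrecToTM2.Γ' :=
  PartrecToTM2.trList [a, b]

/-- The Turing machine `M`, started on the word of the pair `(a, b)`, halts after at most `t` steps
with the word of the pair `(p, q)` as its output. -/
def OutputsPairWithin (M : TM2ComputableAux PartrecToTM2.Γ' PartrecToTM2.Γ')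
    (a b p q t : ℕ) : Prop :=
  Nonempty (TM2OutputsInTime M.tm ((pairWord a b).map M.inputAlphabet.symm)
    (some ((pairWord p q).map M.outputAlphabet.symm)) t)

/-! Breadth-first search from an end of a diameter cuts a `(k;g,d)`-graph into `d + 1` layers.
Recording for each layer its size, its inner edges and its edges to the next layer gives a word
whose weight, the sum of the layer sizes, is at most the order of the graph. Regularity and the
absence of cycles shorter than `g` are conditions on windows of `2g + 1` consecutive letters
(`Window`, `exists_legal_word`). Conversely, a word all of whose cyclic windows are legal (`Closed`)
unrolls to arbitrarily long layered graphs. Boundedly many new vertices repair the two ends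
(`exists_graph_of_closed`), and a tail of bounded size adjusts the diameter to the exact value and
supplies a cycle of length `g` (`exists_mem_girthDiamOrders_le`). Hence `f(k,g)` is the least mean
weight of a closed word, a rational number. The alphabet is infinite, but only finitely many letters
occur in light windows. So a long enough legal word either repeats a block of `2g` letters, and then
a closed word can be cut out of it, or is heavy (`repetition_or_heavy`). By induction, the mean
weight of short closed words bounds the weight of all legal words (`mul_le_of_closed`). This shows
that the minimum is attained, and that a closed word is optimal as soon as it beats the finitely
many closed words below bounds computed from its own weight (`IsOptimal`). Optimality is thus a
primitive recursive test, and an unbounded search finds an optimal word (`exists_partrec`). The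
search becomes a Turing machine (`exists_machine`); `T` is merely its running time. -/

/-! ### Restricting a multi-stack program to finitely many labels -/

namespace RestrictedTM2

open TM2

variable {K : Type*} {Γ : K → Type*} {Λ Λ' σ : Type*}

/-- Relabel the jumps of a statement. -/
def mapStmt (r : Λ → Λ') : Stmt Γ Λ σ → Stmt Γ Λ' σ
  | .push k f q => .push k f (mapStmt r q)
  | .peek k f q => .peek k f (mapStmt r q)
  | .pop k f q => .pop k f (mapStmt r q)
  | .load f q => .load f (mapStmt r q)
  | .branch f q₁ q₂ => .branch f (mapStmt r q₁) (mapStmt r q₂)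
  | .goto f => .goto fun v => r (f v)
  | .halt => .halt

/-- Relabel a configuration. -/
def mapCfg (r : Λ → Λ') (c : Cfg Γ Λ σ) : Cfg Γ Λ' σ :=
  ⟨c.l.map r, c.var, c.stk⟩

theorem stepAux_mapStmt [DecidableEq K] (r : Λ → Λ') (q : Stmt Γ Λ σ) (v : σ)
    (S : ∀ k, List (Γ k)) :
    stepAux (mapStmt r q) v S = mapCfg r (stepAux q v S) := by
  induction q generalizing v S with
  | push k f q ih => exact ih _ _
  | peek k f q ih => exact ih _ _
  | pop k f q ih => exact ih _ _
  | load f q ih => exact ih _ _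
  | branch f q₁ q₂ ih₁ ih₂ =>
    simp only [mapStmt, stepAux]
    cases f v
    · exact ih₂ _ _
    · exact ih₁ _ _
  | goto f => rfl
  | halt => rfl

open Classical in
/-- A retraction of the labels onto a finite set of labels. -/
noncomputable def retract (S : Finset Λ) (a : S) (q : Λ) : S :=
  if h : q ∈ S then ⟨q, h⟩ else a

/-- The restriction of a program to a finite set of labels. -/
noncomputable def restrict (M : Λ → Stmt Γ Λ σ) (S : Finset Λ) (a : S) (q : S) : Stmt Γ S σ :=
  mapStmt (retract S a) (M q)

/-- Only the label of `c` has to lie in `S`: there `retract` is the identity, so the restricted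
program executes the same statement, with its jumps relabelled. -/
theorem step_restrict [DecidableEq K] (M : Λ → Stmt Γ Λ σ) (S : Finset Λ) (a : S)
    {c c' : Cfg Γ Λ σ} (h : c' ∈ step M c) (hc : c.l ∈ Finset.insertNone S) :
    mapCfg (retract S a) c' ∈ step (restrict M S a) (mapCfg (retract S a) c) := by
  obtain ⟨_ | l, v, T⟩ := c
  · simp at h
  · have hl : l ∈ S := Finset.some_mem_insertNone.1 hc
    simp only [step, Option.mem_def, Option.some.injEq] at h
    subst h
    simp only [mapCfg, Option.map_some, step, restrict, stepAux_mapStmt, Option.mem_def]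
    simp [retract, hl]

theorem exists_iterate_of_reaches {σ : Type*} {f : σ → Option σ} {a b : σ}
    (h : StateTransition.Reaches f a b) : ∃ n : ℕ, (flip Bind.bind f)^[n] (some a) = some b := by
  induction h with
  | refl => exact ⟨0, rfl⟩
  | tail _ hbc ih =>
    obtain ⟨n, hn⟩ := ih
    refine ⟨n + 1, ?_⟩
    rw [Function.iterate_succ_apply', hn]
    exact hbc

/-- A supporting set of labels is never left, so the arbitrary value `a` of `retract` never
influences the computation. -/
theorem reaches_restrict [DecidableEq K] [Inhabited Λ] (M : Λ → Stmt Γ Λ σ) (S : Finset Λ)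
    (ss : Supports M S) (a : S) {c c' : Cfg Γ Λ σ} (h : StateTransition.Reaches (step M) c c')
    (hc : c.l ∈ Finset.insertNone S) :
    c'.l ∈ Finset.insertNone S ∧ StateTransition.Reaches (step (restrict M S a))
      (mapCfg (retract S a) c) (mapCfg (retract S a) c') := by
  induction h with
  | refl => exact ⟨hc, .refl⟩
  | tail _ hbc ih =>
    exact ⟨step_supports M ss hbc ih.1, ih.2.tail (step_restrict M S a hbc ih.1)⟩

end RestrictedTM2

/-! ### From partial recursive functions to a finite machine -/

namespace CodeTM

open PartrecToTM2 RestrictedTM2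

theorem mem_codeSupp (c : ToPartrec.Code) : trNormal c .halt ∈ codeSupp c .halt :=
  codeSupp_self _ _ (trStmts₁_self _)

/-- The finite multi-stack machine that evaluates a partial recursive code. -/
noncomputable def machine (c : ToPartrec.Code) : FinTM2 where
  K := K'
  kFin := ⟨{.main, .rev, .aux, .stack}, fun k => by cases k <;> simp⟩
  k₀ := K'.main
  k₁ := K'.main
  Γ := fun _ => Γ'
  Λ := codeSupp c .halt
  main := ⟨trNormal c .halt, mem_codeSupp c⟩
  σ := Option Γ'
  initialState := none
  m := restrict tr (codeSupp c .halt) ⟨trNormal c .halt, mem_codeSupp c⟩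

theorem initList_machine (c : ToPartrec.Code) (v : List ℕ) :
    initList (machine c) (trList v) =
      mapCfg (retract (codeSupp c .halt) ⟨trNormal c .halt, mem_codeSupp c⟩)
        (PartrecToTM2.init c v) := by
  unfold initList mapCfg PartrecToTM2.init
  congr 1
  · simp [machine, retract, mem_codeSupp]
  · funext k
    cases k <;> rfl

theorem haltList_machine (c : ToPartrec.Code) (v : List ℕ) :
    haltList (machine c) (trList v) =
      mapCfg (retract (codeSupp c .halt) ⟨trNormal c .halt, mem_codeSupp c⟩)
        (PartrecToTM2.halt v) := by
  unfold haltList mapCfg PartrecToTM2.halt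
  congr 1
  funext k
  cases k <;> rfl

/-- The universal program `tr` has infinitely many labels, but evaluating `c` stays in the finite
set `codeSupp c .halt`. The time `t` is the length of the halting run. -/
theorem exists_outputs (c : ToPartrec.Code) (v w : List ℕ) (h : w ∈ c.eval v) :
    ∃ t, Nonempty (TM2OutputsInTime (machine c) (trList v) (some (trList w)) t) := by
  have h1 : PartrecToTM2.halt w ∈ StateTransition.eval (TM2.step tr) (PartrecToTM2.init c v) := by
    rw [PartrecToTM2.tr_eval]
    exact (Part.mem_map_iff _).2 ⟨w, h, rfl⟩
  have h2 := (StateTransition.mem_eval.1 h1).1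
  let _ : Inhabited Λ' := ⟨trNormal c .halt⟩
  have h3 := (reaches_restrict tr (codeSupp c .halt) (tr_supports c .halt)
    ⟨trNormal c .halt, mem_codeSupp c⟩ h2 (Finset.some_mem_insertNone.2 (mem_codeSupp c))).2
  rw [← initList_machine, ← haltList_machine] at h3
  obtain ⟨n, hn⟩ := exists_iterate_of_reaches h3
  exact ⟨n, ⟨⟨⟨n, hn⟩, le_rfl⟩⟩⟩

/-- Two partial recursive functions of two variables are computed, as a pair, by one finite
multi-stack machine, on all arguments at which both of them are defined. -/
theorem exists_machine {p q : ℕ → ℕ →. ℕ} (hp : Partrec₂ p) (hq : Partrec₂ q) :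
    ∃ M : TM2ComputableAux Γ' Γ', (∀ i : M.tm.K, Finite (M.tm.Γ i)) ∧
      ∀ a b x y, x ∈ p a b → y ∈ q a b → ∃ t, OutputsPairWithin M a b x y t := by
  obtain ⟨cp, hcp⟩ := ToPartrec.Code.exists_code (Nat.Partrec'.part_iff₂.2 hp)
  obtain ⟨cq, hcq⟩ := ToPartrec.Code.exists_code (Nat.Partrec'.part_iff₂.2 hq)
  refine ⟨⟨machine (.cons cp cq), Equiv.refl Γ', Equiv.refl Γ'⟩,
    fun _ => (inferInstance : Finite Γ'), fun a b x y hx hy => ?_⟩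
  have h1 : [x] ∈ cp.eval [a, b] := by
    have := hcp ⟨[a, b], rfl⟩
    rw [this]
    exact (Part.mem_map_iff _).2 ⟨x, hx, rfl⟩
  have h2 : [y] ∈ cq.eval [a, b] := by
    have := hcq ⟨[a, b], rfl⟩
    rw [this]
    exact (Part.mem_map_iff _).2 ⟨y, hy, rfl⟩
  have h3 : [x, y] ∈ (ToPartrec.Code.cons cp cq).eval [a, b] := by
    simp only [ToPartrec.Code.eval]
    exact Part.mem_bind h1 (Part.mem_bind h2 (Part.mem_some _))
  obtain ⟨t, ht⟩ := exists_outputs _ _ _ h3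
  have map_symm (l : List Γ') : l.map (Equiv.refl Γ').symm = l := List.map_id' l
  refine ⟨t, ?_⟩
  have key : ∀ l l' : List Γ', l = trList [a, b] → l' = trList [x, y] →
      Nonempty (TM2OutputsInTime (machine (.cons cp cq)) l (some l') t) := by
    rintro _ _ rfl rfl
    exact ht
  exact key _ _ (map_symm _) (map_symm _)

end CodeTM

/-! ### Words with local constraints and their mean weight -/

namespace SlidingWord

variable {S : Type*}

/-- All windows of length `w + 1` inside the first `d` letters of `s` satisfy `P`. -/
def Legal (P : (ℕ → S) → Prop) (w : ℕ) (s : ℕ → S) (d : ℕ) : Prop :=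
  ∀ i, i + w < d → P fun t => s (i + t)

/-- The periodic continuation of a word. -/
def cyc [Inhabited S] (u : List S) (i : ℕ) : S :=
  u.getD (i % u.length) default

/-- A nonempty word all of whose cyclic windows satisfy `P`. -/
def Closed [Inhabited S] (P : (ℕ → S) → Prop) (u : List S) : Prop :=
  u ≠ [] ∧ ∀ i, P fun t => cyc u (i + t)

/-- The total weight of a word. -/
def weight (wt : S → ℕ) (u : List S) : ℕ :=
  (u.map wt).sum

theorem cyc_add_length [Inhabited S] (u : List S) (i : ℕ) : cyc u (i + u.length) = cyc u i := by
  simp [cyc]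

theorem cyc_of_lt [Inhabited S] (u : List S) {i : ℕ} (h : i < u.length) :
    cyc u i = u[i] := by
  simp [cyc, Nat.mod_eq_of_lt h, h]

theorem cyc_mod_add [Inhabited S] (u : List S) (i t : ℕ) :
    cyc u (i % u.length + t) = cyc u (i + t) := by
  simp [cyc]

theorem cyc_mem [Inhabited S] {u : List S} (hu : u ≠ []) (i : ℕ) : cyc u i ∈ u := by
  have hi : i % u.length < u.length := Nat.mod_lt _ (List.length_pos_of_ne_nil hu)
  rw [cyc, List.getD_eq_getElem _ _ hi]
  exact List.getElem_mem hi

theorem weight_map_range (wt : S → ℕ) (f : ℕ → S) (n : ℕ) :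
    weight wt ((List.range n).map f) = ∑ i ∈ Finset.range n, wt (f i) := by
  rw [weight, List.map_map]
  rfl

theorem map_range_cyc [Inhabited S] (u : List S) : (List.range u.length).map (cyc u) = u := by
  refine List.ext_getElem (by simp) fun i h1 h2 => ?_
  simp [cyc_of_lt u h2]

theorem sum_cyc [Inhabited S] (wt : S → ℕ) (u : List S) :
    ∑ i ∈ Finset.range u.length, wt (cyc u i) = weight wt u := by
  rw [← weight_map_range, map_range_cyc]

theorem sum_range_mul_block (f : ℕ → ℕ) (a R : ℕ) :
    ∑ i ∈ Finset.range (a * R), f i =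
      ∑ r ∈ Finset.range R, ∑ t ∈ Finset.range a, f (a * r + t) := by
  induction R with
  | zero => simp
  | succ R ih => rw [Nat.mul_succ, Finset.sum_range_add, ih, Finset.sum_range_succ]

theorem sum_cyc_mul [Inhabited S] (wt : S → ℕ) (u : List S) (n : ℕ) :
    ∑ i ∈ Finset.range (u.length * n), wt (cyc u i) = n * weight wt u := by
  rw [sum_range_mul_block, ← sum_cyc]
  have h (r : ℕ) : ∑ t ∈ Finset.range u.length, wt (cyc u (u.length * r + t)) =
      ∑ t ∈ Finset.range u.length, wt (cyc u t) := by
    refine Finset.sum_congr rfl fun t _ => ?_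
    rw [← cyc_mod_add u (u.length * r)]
    simp
  simp [h]

/-- The word that is left when the letters in `[i, i + p)` are deleted. -/
def delete (s : ℕ → S) (i p t : ℕ) : S :=
  if t < i then s t else s (t + p)

theorem sum_delete (wt : S → ℕ) (s : ℕ → S) (i p e : ℕ) :
    ∑ t ∈ Finset.range (i + e + p), wt (s t) =
      ∑ t ∈ Finset.range p, wt (s (i + t)) + ∑ t ∈ Finset.range (i + e), wt (delete s i p t) := by
  rw [show i + e + p = i + p + e by ring, Finset.sum_range_add, Finset.sum_range_add,
    Finset.sum_range_add]
  have h1 : ∑ t ∈ Finset.range i, wt (delete s i p t) = ∑ t ∈ Finset.range i, wt (s t) :=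
    Finset.sum_congr rfl fun t ht => by simp [delete, Finset.mem_range.1 ht]
  have h2 : ∑ t ∈ Finset.range e, wt (delete s i p (i + t)) =
      ∑ t ∈ Finset.range e, wt (s (i + p + t)) :=
    Finset.sum_congr rfl fun t _ => by simp [delete, add_right_comm]
  omega

section Cut

variable {P : (ℕ → S) → Prop} {w : ℕ}

/-- Since the `w` letters after the gap equal the first `w` letters from position `i`, a window that
starts before the gap reads what it read in `s`, and every other window is a shifted window of `s`.
-/
theorem legal_delete (hP : ∀ v v' : ℕ → S, (∀ t ≤ w, v t = v' t) → P v → P v')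
    {s : ℕ → S} {i p e : ℕ} (hs : Legal P w s (i + e + p))
    (heq : ∀ t < w, s (i + t) = s (i + p + t)) : Legal P w (delete s i p) (i + e) := by
  intro r hr
  by_cases h : r < i
  · refine hP _ _ (fun t ht => ?_) (hs r (by omega))
    simp only [delete]
    split_ifs with h1
    · rfl
    · have := heq (r + t - i) (by omega)
      rw [show i + (r + t - i) = r + t by omega, show i + p + (r + t - i) = r + t + p by omega]
        at this
      exact this
  · refine hP _ _ (fun t ht => ?_) (hs (r + p) (by omega))
    rw [delete, if_neg (by omega), add_right_comm]

/-- The repetition makes the periodic continuation agree with `s` on `p + w` letters, also if `p <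
w`. These contain every window that starts within one period. -/
theorem closed_of_eq [Inhabited S] (hP : ∀ v v' : ℕ → S, (∀ t ≤ w, v t = v' t) → P v → P v')
    {s : ℕ → S} {i p d : ℕ} (hp : 0 < p) (hs : Legal P w s d) (hd : i + p + w ≤ d)
    (heq : ∀ t < w, s (i + t) = s (i + p + t)) :
    Closed P ((List.range p).map fun t => s (i + t)) := by
  set u := (List.range p).map fun t => s (i + t) with hu
  have hlen : u.length = p := by simp [hu]
  have hcyc : ∀ r, r < p + w → cyc u r = s (i + r) := by
    intro r
    induction r using Nat.strong_induction_on with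
    | _ r ih =>
      intro hr
      by_cases h : r < p
      · rw [cyc_of_lt u (by omega)]
        simp [hu]
      · obtain ⟨r', rfl⟩ := Nat.exists_eq_add_of_le' (not_lt.1 h)
        have := cyc_add_length u r'
        rw [hlen] at this
        rw [this, ih r' (by omega) (by omega), heq r' (by omega)]
        congr 1
        ring
  refine ⟨fun h => by simp [h] at hlen; omega, fun r => ?_⟩
  have hr : r % u.length < p := by rw [hlen]; exact Nat.mod_lt _ hp
  refine hP _ _ (fun t ht => ?_) (hs (i + r % u.length) (by omega))
  rw [← cyc_mod_add, hcyc _ (by omega), add_assoc]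

theorem legal_drop {s : ℕ → S} {a d : ℕ} (hs : Legal P w s (a + d)) :
    Legal P w (fun t => s (a + t)) d := by
  intro i hi
  have := hs (a + i) (by omega)
  simpa only [add_assoc] using this

end Cut

section Bound

variable {P : (ℕ → S) → Prop} {w : ℕ} {wt : S → ℕ} {F : Finset S} {B : ℕ}

/-- Pigeonhole on `2K` disjoint blocks of length `w + 1`, with `K = F.card ^ w`: light blocks start
with `w` letters of `F`, so without a repetition at most `K` blocks are light, and each of the other
blocks weighs at least `B + 1`. -/
theorem repetition_or_heavy
    (hF : ∀ v, P v → ∑ t ∈ Finset.range (w + 1), wt (v t) ≤ B → ∀ t < w, v t ∈ F)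
    {s : ℕ → S} {d : ℕ} (hs : Legal P w s d) (hd : (w + 1) * (2 * F.card ^ w) ≤ d) :
    (∃ i p e, 0 < p ∧ i + e + p = d ∧ i + p + w ≤ (w + 1) * (2 * F.card ^ w) ∧
      ∀ t < w, s (i + t) = s (i + p + t)) ∨
    (B + 1) * F.card ^ w ≤ ∑ i ∈ Finset.range ((w + 1) * (2 * F.card ^ w)), wt (s i) := by
  classical
  set K := F.card ^ w with hK
  rw [or_iff_not_imp_left]
  intro hno
  let W (r : ℕ) : ℕ := ∑ t ∈ Finset.range (w + 1), wt (s ((w + 1) * r + t))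
  let small := (Finset.range (2 * K)).filter fun r => W r ≤ B
  let big := (Finset.range (2 * K)).filter fun r => ¬ W r ≤ B
  have hlt : ∀ r < 2 * K, (w + 1) * r + w < (w + 1) * (2 * K) := by
    intro r hr
    calc (w + 1) * r + w < (w + 1) * (r + 1) := by rw [Nat.mul_succ]; omega
      _ ≤ _ := Nat.mul_le_mul_left _ hr
  have hinj : Set.InjOn (fun r (t : Fin w) => s ((w + 1) * r + t)) small := by
    have key : ∀ r ∈ small, ∀ r' ∈ small, r < r' →
        (fun t : Fin w => s ((w + 1) * r + t)) ≠ fun t : Fin w => s ((w + 1) * r' + t) := by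
      intro r hr r' hr' hrr heq
      refine hno ⟨(w + 1) * r, (w + 1) * r' - (w + 1) * r, d - (w + 1) * r', ?_, ?_, ?_, ?_⟩
      all_goals
        have h1 : (w + 1) * r < (w + 1) * r' := Nat.mul_lt_mul_of_pos_left hrr (by omega)
        have h2 := hlt r' (Finset.mem_range.1 (Finset.mem_filter.1 hr').1)
      · omega
      · omega
      · omega
      · intro t ht
        rw [Nat.add_sub_cancel' h1.le]
        exact congrFun heq ⟨t, ht⟩
    intro r hr r' hr' heq
    rcases lt_trichotomy r r' with h | h | h
    · exact absurd heq (key r hr r' hr' h)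
    · exact h
    · exact absurd heq.symm (key r' hr' r hr h)
  have hsmall : small.card ≤ K := by
    have : small.card ≤ (Fintype.piFinset fun _ : Fin w => F).card := by
      refine Finset.card_le_card_of_injOn _ (fun r hr => ?_) hinj
      have hr' := Finset.mem_filter.1 hr
      refine Finset.mem_coe.2 (Fintype.mem_piFinset.2 fun t => ?_)
      exact hF _ (hs ((w + 1) * r) (lt_of_lt_of_le (hlt r (Finset.mem_range.1 hr'.1)) hd))
        hr'.2 t t.2
    simpa [Fintype.card_piFinset_const] using this
  have hbig : K ≤ big.card := by
    have := Finset.card_filter_add_card_filter_not (s := Finset.range (2 * K)) fun r => W r ≤ B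
    rw [Finset.card_range] at this
    change small.card + big.card = _ at this
    omega
  calc (B + 1) * K ≤ (B + 1) * big.card := Nat.mul_le_mul_left _ hbig
    _ = ∑ r ∈ big, (B + 1) := by simp [mul_comm]
    _ ≤ ∑ r ∈ big, W r := Finset.sum_le_sum fun r hr => by
        have := (Finset.mem_filter.1 hr).2
        omega
    _ ≤ ∑ r ∈ Finset.range (2 * K), W r :=
        Finset.sum_le_sum_of_subset (Finset.filter_subset _ _)
    _ = _ := (sum_range_mul_block (fun i => wt (s i)) (w + 1) (2 * K)).symm

/-- A lower bound for the weight of a legal word from a lower bound for the mean weight of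
short closed words. -/
theorem mul_le_of_closed [Inhabited S] (hP : ∀ v v' : ℕ → S, (∀ t ≤ w, v t = v' t) → P v → P v') {A m p N : ℕ}
    (hF : ∀ v, P v → ∑ t ∈ Finset.range (w + 1), wt (v t) ≤ 2 * A * (w + 1) → ∀ t < w, v t ∈ F)
    (hF0 : 0 < F.card) (hN : N = (w + 1) * (2 * F.card ^ w)) (hmp : m ≤ A * p)
    (hcl : ∀ u, Closed P u → u.length ≤ N → m * u.length ≤ p * weight wt u) :
    ∀ d (s : ℕ → S), Legal P w s d → m * d ≤ p * ∑ i ∈ Finset.range d, wt (s i) + m * N := by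
  intro d
  induction d using Nat.strong_induction_on with
  | _ d ih =>
    intro s hs
    by_cases hd : d ≤ N
    · exact (Nat.mul_le_mul_left _ hd).trans (Nat.le_add_left _ _)
    push Not at hd
    -- Either a closed factor of length at most `N` is cut out, or the heavy prefix of length `N` is
    -- dropped; in both cases the removed part has mean at least `m / p`.
    rcases repetition_or_heavy hF hs (hN ▸ hd.le) with ⟨i, q, e, hq, rfl, hiq, heq⟩ | hheavy
    · have h1 := hcl _ (closed_of_eq hP hq hs (by omega) heq) (by simp; omega)
      have h2 := ih (i + e) (by omega) _ (legal_delete hP hs heq)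
      rw [sum_delete]
      rw [weight_map_range, List.length_map, List.length_range] at h1
      nlinarith
    · obtain ⟨d', rfl⟩ := Nat.exists_eq_add_of_le hd.le
      rw [← hN] at hheavy
      have hN0 : 0 < N := by
        rw [hN]
        have := pow_pos hF0 w
        positivity
      have h2 := ih d' (by omega) _ (legal_drop hs)
      rw [Finset.sum_range_add]
      -- With `B = 2 * A * (w + 1)` one has `A * N = B * F.card ^ w`; this is why `B` contains the
      -- factor 2.
      have h3 : A * N ≤ ∑ i ∈ Finset.range N, wt (s i) := by
        refine le_trans ?_ hheavy
        rw [hN]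
        nlinarith [Nat.zero_le (F.card ^ w)]
      have h4 : m * N ≤ p * ∑ i ∈ Finset.range N, wt (s i) :=
        calc m * N ≤ A * p * N := Nat.mul_le_mul_right _ hmp
          _ = p * (A * N) := by ring
          _ ≤ _ := Nat.mul_le_mul_left _ h3
      nlinarith

theorem legal_cyc [Inhabited S] {u : List S} (hu : Closed P u) (d : ℕ) : Legal P w (cyc u) d :=
  fun i _ => hu.2 i

/-- Multiplied by `L!`, the means of words of length at most `L` are natural numbers, so a least one
exists although there may be infinitely many words. -/
theorem exists_minimal_mean_of_length_le [Inhabited S] {u₀ : List S} (h₀ : Closed P u₀) {L : ℕ}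
    (hL : u₀.length ≤ L) : ∃ u, Closed P u ∧ ∀ u', Closed P u' → u'.length ≤ L →
      weight wt u * u'.length ≤ weight wt u' * u.length := by
  let f (u : {u : List S // Closed P u ∧ u.length ≤ L}) : ℕ :=
    weight wt u.1 * (L.factorial / u.1.length)
  have : Nonempty {u : List S // Closed P u ∧ u.length ≤ L} := ⟨⟨u₀, h₀, hL⟩⟩
  obtain ⟨⟨u, hu, huL⟩, hmin⟩ : ∃ u, ∀ u', f u ≤ f u' :=
    ⟨Function.argmin f, fun u' => Function.argmin_le f u'⟩
  refine ⟨u, hu, fun u' hu' hL' => ?_⟩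
  have h1 := hmin ⟨u', hu', hL'⟩
  simp only [f] at h1
  obtain ⟨c, hc⟩ := Nat.dvd_factorial (List.length_pos_of_ne_nil hu.1) huL
  obtain ⟨c', hc'⟩ := Nat.dvd_factorial (List.length_pos_of_ne_nil hu'.1) hL'
  have hd : L.factorial / u.length = c := by
    rw [hc, Nat.mul_div_cancel_left _ (List.length_pos_of_ne_nil hu.1)]
  have hd' : L.factorial / u'.length = c' := by
    rw [hc', Nat.mul_div_cancel_left _ (List.length_pos_of_ne_nil hu'.1)]
  rw [hd, hd'] at h1
  refine Nat.le_of_mul_le_mul_right ?_ (Nat.factorial_pos L)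
  calc weight wt u * u'.length * L.factorial
      = weight wt u * c * (u.length * u'.length) := by rw [hc]; ring
    _ ≤ weight wt u' * c' * (u.length * u'.length) := Nat.mul_le_mul_right _ h1
    _ = weight wt u' * u.length * L.factorial := by rw [hc']; ring

/-- Among all closed words there is one of least mean weight. -/
theorem exists_minimal_mean [Inhabited S]
    (hP : ∀ v v' : ℕ → S, (∀ t ≤ w, v t = v' t) → P v → P v')
    (hF : ∀ B, ∃ F : Finset S, 0 < F.card ∧
      ∀ v, P v → ∑ t ∈ Finset.range (w + 1), wt (v t) ≤ B → ∀ t < w, v t ∈ F)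
    (h : ∃ u, Closed P u) : ∃ u, Closed P u ∧ ∀ u', Closed P u' →
      weight wt u * u'.length ≤ weight wt u' * u.length := by
  obtain ⟨u₀, h₀⟩ := h
  obtain ⟨F, hF0, hF⟩ := hF (2 * weight wt u₀ * (w + 1))
  obtain ⟨N, hN⟩ : ∃ N, N = (w + 1) * (2 * F.card ^ w) := ⟨_, rfl⟩
  obtain ⟨u, hu, hmin⟩ := exists_minimal_mean_of_length_le (wt := wt) h₀ (le_max_right N u₀.length)
  refine ⟨u, hu, fun u' hu' => ?_⟩
  have hu₀ := List.length_pos_of_ne_nil h₀.1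
  have hmp : weight wt u ≤ weight wt u₀ * u.length :=
    (Nat.le_mul_of_pos_right _ hu₀).trans (hmin u₀ h₀ (le_max_right _ _))
  have hlin := mul_le_of_closed hP hF hF0 hN hmp fun u'' h1 h2 => by
    rw [mul_comm u.length]
    exact hmin u'' h1 (h2.trans (le_max_left _ _))
  -- Repeating `u'` more than `weight wt u * N` times beats the additive error `weight wt u * N` of
  -- the linear bound.
  have hper := hlin (u'.length * (weight wt u * N + 1)) (cyc u') (legal_cyc hu' _)
  rw [sum_cyc_mul] at hper
  by_contra! hlt
  have h3 : (weight wt u' * u.length + 1) * (weight wt u * N + 1) ≤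
      weight wt u * u'.length * (weight wt u * N + 1) := Nat.mul_le_mul_right _ hlt
  nlinarith

/-- If there are long legal words of bounded mean weight, then there is a closed word. -/
theorem exists_closed [Inhabited S]
    (hP : ∀ v v' : ℕ → S, (∀ t ≤ w, v t = v' t) → P v → P v')
    (hF : ∀ B, ∃ F : Finset S, 0 < F.card ∧
      ∀ v, P v → ∑ t ∈ Finset.range (w + 1), wt (v t) ≤ B → ∀ t < w, v t ∈ F) (A : ℕ)
    (h : ∀ d₀, ∃ d s, d₀ ≤ d ∧ Legal P w s d ∧ ∑ i ∈ Finset.range d, wt (s i) ≤ A * d) :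
    ∃ u, Closed P u := by
  by_contra! hno
  obtain ⟨F, hF0, hF⟩ := hF (2 * (A + 1) * (w + 1))
  obtain ⟨N, hN⟩ : ∃ N, N = (w + 1) * (2 * F.card ^ w) := ⟨_, rfl⟩
  -- Without closed words the hypothesis on them is void, and long legal words would have mean close
  -- to `A + 1` or more.
  have hlin := mul_le_of_closed hP hF hF0 hN (m := A + 1) (p := 1) (by simp)
    fun u hu _ => absurd hu (hno u)
  obtain ⟨d, s, hd, hs, hA⟩ := h ((A + 1) * N + 1)
  have := hlin d s hs
  nlinarith

end Bound

end SlidingWord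

/-! ### Layered graphs as words, and the local conditions on them -/

namespace LayerWord

open SlidingWord

/-- The digit of `e` at position `j` is one. -/
def HasBit (e j : ℕ) : Prop := e / 2 ^ j % 2 = 1

instance (e j : ℕ) : Decidable (HasBit e j) := inferInstanceAs (Decidable (_ = _))

/-- A letter `(a, e)` describes a layer with vertices `0, …, a - 1`; the digits of `e` at even
positions describe the edges inside the layer. -/
def Inner (σ : ℕ × ℕ) (x y : ℕ) : Prop := HasBit σ.2 (2 * Nat.pair x y)

/-- The digits of `e` at odd positions describe the edges to the next layer. -/
def Outer (σ : ℕ × ℕ) (x y : ℕ) : Prop := HasBit σ.2 (2 * Nat.pair x y + 1)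

instance (σ : ℕ × ℕ) (x y : ℕ) : Decidable (Inner σ x y) := inferInstanceAs (Decidable (HasBit _ _))
instance (σ : ℕ × ℕ) (x y : ℕ) : Decidable (Outer σ x y) := inferInstanceAs (Decidable (HasBit _ _))

/-- Adjacency of the vertices `(i, x)` and `(j, y)` of the layered graph of a word. -/
def WAdj (v : ℕ → ℕ × ℕ) (z z' : ℕ × ℕ) : Prop :=
  (z.1 = z'.1 ∧ z.2 ≠ z'.2 ∧ (Inner (v z.1) z.2 z'.2 ∨ Inner (v z.1) z'.2 z.2)) ∨
  (z'.1 = z.1 + 1 ∧ Outer (v z.1) z.2 z'.2) ∨ (z.1 = z'.1 + 1 ∧ Outer (v z'.1) z'.2 z.2)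

instance (v : ℕ → ℕ × ℕ) (z z' : ℕ × ℕ) : Decidable (WAdj v z z') :=
  inferInstanceAs (Decidable (_ ∨ _))

/-- The number of digits needed to describe edges between vertices with numbers at most `b`. -/
def digits (b : ℕ) : ℕ := 2 * Nat.pair b b + 2

/-- The local conditions, around the layer `g`, on a word that describes a layered `k`-regular
graph without cycles shorter than `g` in which every vertex has a neighbour in the previous layer,
and the number of edges between consecutive layers is even if `k` is. -/
structure Window (k g : ℕ) (v : ℕ → ℕ × ℕ) : Prop where
  bounded : ∀ t < 2 * g, (v t).2 < 2 ^ digits (max (v t).1 (v (t + 1)).1)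
  pos : 0 < (v g).1
  regular : ∀ x < (v g).1, ∑ t ∈ Finset.range 3, ∑ y ∈ Finset.range (v (g - 1 + t)).1,
    (if WAdj v (g, x) (g - 1 + t, y) then 1 else 0) = k
  back : ∀ x < (v g).1, ∃ y < (v (g - 1)).1, Outer (v (g - 1)) y x
  even_cut : k % 2 = 0 → (∑ x ∈ Finset.range (v g).1, ∑ y ∈ Finset.range (v (g + 1)).1,
    (if Outer (v g) x y then 1 else 0)) % 2 = 0
  no_short_cycle : ∀ l : List (ℕ × ℕ), 3 ≤ l.length → l.length < g →
    (∀ z ∈ l, z.1 ≤ 2 * g ∧ z.2 < (v z.1).1) → l.Nodup →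
    ¬ ∀ i < l.length, WAdj v (l.getD i (0, 0)) (l.getD ((i + 1) % l.length) (0, 0))

theorem WAdj.symm {v : ℕ → ℕ × ℕ} {z z' : ℕ × ℕ} (h : WAdj v z z') : WAdj v z' z := by
  rcases h with ⟨h1, h2, h3⟩ | h | h
  · exact .inl ⟨h1.symm, h2.symm, by rw [← h1]; exact h3.symm⟩
  · exact .inr (.inr h)
  · exact .inr (.inl h)

theorem WAdj.ne {v : ℕ → ℕ × ℕ} {z z' : ℕ × ℕ} (h : WAdj v z z') : z ≠ z' := by
  rintro rfl
  rcases h with ⟨-, h2, -⟩ | ⟨h, -⟩ | ⟨h, -⟩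
  · exact h2 rfl
  · omega
  · omega

theorem wadj_congr {v v' : ℕ → ℕ × ℕ} {z z' : ℕ × ℕ} (h : v z.1 = v' z.1) (h' : v z'.1 = v' z'.1) :
    WAdj v z z' ↔ WAdj v' z z' := by
  rw [WAdj, WAdj, h, h']

theorem wadj_shift (v : ℕ → ℕ × ℕ) (i : ℕ) (z z' : ℕ × ℕ) :
    WAdj (fun t => v (i + t)) z z' ↔ WAdj v (i + z.1, z.2) (i + z'.1, z'.2) := by
  simp only [WAdj, add_assoc, add_right_inj]

theorem Window.congr {k g : ℕ} (hg : 1 ≤ g) (v v' : ℕ → ℕ × ℕ) (h : ∀ t ≤ 2 * g, v t = v' t)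
    (hv : Window k g v) : Window k g v' := by
  have hvg := h g (by omega)
  have hvg1 := h (g - 1) (by omega)
  have hvg2 := h (g + 1) (by omega)
  refine ⟨fun t ht => ?_, ?_, fun x hx => ?_, fun x hx => ?_, fun hk => ?_, fun l h1 h2 h3 h4 h5 => ?_⟩
  · rw [← h t (by omega), ← h (t + 1) (by omega)]
    exact hv.bounded t ht
  · rw [← hvg]
    exact hv.pos
  · rw [← hvg] at hx
    rw [← hv.regular x hx]
    refine Finset.sum_congr rfl fun t ht => ?_
    have ht' := Finset.mem_range.1 ht
    have hvt := h (g - 1 + t) (by omega)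
    rw [← hvt]
    refine Finset.sum_congr rfl fun y _ => ?_
    simp only [wadj_congr (v := v) (v' := v') (z := (g, x)) (z' := (g - 1 + t, y)) hvg hvt]
  · rw [← hvg] at hx
    rw [← hvg1]
    exact hv.back x hx
  · rw [← hvg, ← hvg2]
    exact hv.even_cut hk
  · have h3' : ∀ z ∈ l, z.1 ≤ 2 * g ∧ z.2 < (v z.1).1 := fun z hz => by
      rw [h z.1 (h3 z hz).1]
      exact h3 z hz
    refine hv.no_short_cycle l h1 h2 h3' h4 fun i hi => ?_
    have hm (j : ℕ) (hj : j < l.length) : l.getD j (0, 0) ∈ l := by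
      rw [List.getD_eq_getElem _ _ hj]
      exact List.getElem_mem hj
    refine (wadj_congr (h _ (h3 _ (hm i hi)).1) (h _ (h3 _ (hm _ (Nat.mod_lt _ ?_))).1)).2 (h5 i hi)
    omega

theorem digits_mono : Monotone digits := fun a b h => by
  unfold digits
  have : Nat.pair a a ≤ Nat.pair b b := by
    rcases h.eq_or_lt with rfl | h
    · rfl
    · exact (Nat.pair_lt_pair_left a h).le.trans (Nat.pair_lt_pair_right b h).le
  omega

theorem pair_lt_digits {x y b : ℕ} (hx : x ≤ b) (hy : y ≤ b) :
    2 * Nat.pair x y + 1 < digits b := by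
  unfold digits
  have h1 : Nat.pair x y ≤ Nat.pair b y := by
    rcases hx.eq_or_lt with rfl | h
    · rfl
    · exact (Nat.pair_lt_pair_left y h).le
  have h2 : Nat.pair b y ≤ Nat.pair b b := by
    rcases hy.eq_or_lt with rfl | h
    · rfl
    · exact (Nat.pair_lt_pair_right b h).le
  omega

/-- The letters of weight at most `B` whose second entry has few digits. -/
def letters (B : ℕ) : Finset (ℕ × ℕ) :=
  Finset.range (B + 1) ×ˢ Finset.range (2 ^ digits B)

theorem card_letters (B : ℕ) : (letters B).card = (B + 1) * 2 ^ digits B := by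
  simp [letters]

/-- The last letter of the window is excluded: its edge code also depends on the size of a layer
outside the window. -/
theorem Window.mem_letters {k g B : ℕ} {v : ℕ → ℕ × ℕ} (hv : Window k g v)
    (hB : ∑ t ∈ Finset.range (2 * g + 1), (v t).1 ≤ B) (t : ℕ) (ht : t < 2 * g) :
    v t ∈ letters B := by
  have h (t : ℕ) (ht : t ≤ 2 * g) : (v t).1 ≤ B :=
    (Finset.single_le_sum (f := fun t => (v t).1) (fun _ _ => Nat.zero_le _)
      (Finset.mem_range.2 (Nat.lt_succ_of_le ht))).trans hB
  refine Finset.mem_product.2 ⟨Finset.mem_range.2 (Nat.lt_succ_of_le (h t ht.le)),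
    Finset.mem_range.2 ((hv.bounded t ht).trans_le (Nat.pow_le_pow_right (by norm_num) ?_))⟩
  exact digits_mono (max_le (h t ht.le) (h (t + 1) ht))

theorem exists_letters (k g B : ℕ) : ∃ F : Finset (ℕ × ℕ), 0 < F.card ∧ ∀ v, Window k g v →
    ∑ t ∈ Finset.range (2 * g + 1), (v t).1 ≤ B → ∀ t < 2 * g, v t ∈ F :=
  ⟨letters B, by rw [card_letters]; positivity, fun _ hv hB t ht => hv.mem_letters hB t ht⟩

end LayerWord

/-! ### Girth certified by Lipschitz functions; opening an edge to join half-edges -/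

namespace GirthGraph

variable {V W : Type}

open Classical in
/-- The degree of a vertex of a finite graph, as a sum. -/
noncomputable def dg [Fintype V] (G : SimpleGraph V) (x : V) : ℕ :=
  ∑ y, if G.Adj x y then 1 else 0

/-- `G` has no cycle shorter than `g`: for each edge `xy` there is a function that changes by at
most one along all other edges and by at least `g - 1` between `x` and `y`. -/
def GirthGe (G : SimpleGraph V) (g : ℕ) : Prop :=
  ∀ x y, G.Adj x y → ∃ φ : V → ℕ, φ x = 0 ∧ g ≤ φ y + 1 ∧
    ∀ z w, G.Adj z w → s(z, w) ≠ s(x, y) → φ w ≤ φ z + 1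

theorem le_add_length_of_lipschitz {G : SimpleGraph V} {φ : V → ℕ} {E : Set (Sym2 V)}
    (hφ : ∀ z w, G.Adj z w → s(z, w) ∉ E → φ w ≤ φ z + 1) {u v : V} (p : G.Walk u v)
    (hp : ∀ e ∈ p.edges, e ∉ E) : φ v ≤ φ u + p.length := by
  induction p with
  | nil => simp
  | cons h p ih =>
    have h1 := hφ _ _ h (hp _ (by simp))
    have h2 := ih fun e he => hp e (by simp [he])
    rw [SimpleGraph.Walk.length_cons]
    omega

theorem GirthGe.le_length {G : SimpleGraph V} {g : ℕ} (hG : GirthGe G g) {v : V} (p : G.Walk v v)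
    (hp : p.IsCycle) : g ≤ p.length := by
  cases p with
  | nil => exact absurd hp (by simp)
  | @cons _ u _ h p =>
    rw [SimpleGraph.Walk.cons_isCycle_iff] at hp
    obtain ⟨φ, h1, h2, h3⟩ := hG u v h.symm
    rw [Sym2.eq_swap] at hp
    have h4 := le_add_length_of_lipschitz (E := {s(u, v)}) (fun z w hzw hE => h3 z w hzw hE) p
      (fun e he hE => hp.2 (by rw [Set.mem_singleton_iff] at hE; exact hE ▸ he))
    rw [SimpleGraph.Walk.length_cons]
    omega

theorem GirthGe.le_of_cyclic {G : SimpleGraph V} {g : ℕ} (hG : GirthGe G g) {n : ℕ} (hn : 3 ≤ n)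
    {q : ℕ → V} (hq : Set.InjOn q (Set.Iio n))
    (hadj : ∀ i < n, G.Adj (q i) (q ((i + 1) % n))) : g ≤ n := by
  have hlast := hadj (n - 1) (by omega)
  rw [Nat.sub_add_cancel (by omega), Nat.mod_self] at hlast
  obtain ⟨φ, h1, h2, h3⟩ := hG _ _ hlast.symm
  have h4 : ∀ i < n, φ (q i) ≤ i := by
    intro i
    induction i with
    | zero => intro; exact h1.le
    | succ i ih =>
      intro hi
      have h5 := hadj i (by omega)
      rw [Nat.mod_eq_of_lt hi] at h5
      have h6 := h3 _ _ h5 (fun h => by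
        rcases Sym2.eq_iff.1 h with ⟨h7, h8⟩ | ⟨h7, h8⟩
        · have := hq (show i + 1 < n from hi) (show n - 1 < n by omega) h8
          have := hq (show i < n by omega) (show 0 < n by omega) h7
          omega
        · have := hq (show i + 1 < n from hi) (show 0 < n by omega) h8
          omega)
      have := ih (by omega)
      omega
  have := h4 (n - 1) (by omega)
  omega

/-- The certificate for an edge `xy` is the distance from `x` after deletion of that edge, truncated
at `g`. If it were small at `y`, a path together with `xy` would be a short cycle. -/
theorem girthGe_of_not_cyclic {G : SimpleGraph V} {g : ℕ}
    (h : ∀ n, 3 ≤ n → n < g → ∀ q : ℕ → V, Set.InjOn q (Set.Iio n) →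
      ¬ ∀ i < n, G.Adj (q i) (q ((i + 1) % n))) : GirthGe G g := by
  classical
  intro x y hxy
  set G' := G.deleteEdges {s(x, y)} with hG'
  let A (z : V) : Set ℕ := {n | n = g ∨ ∃ p : G'.Walk x z, p.length = n}
  have hA (z : V) : (A z).Nonempty := ⟨g, .inl rfl⟩
  have hmem (z : V) : sInf (A z) ∈ A z := Nat.sInf_mem (hA z)
  have hg (z : V) : sInf (A z) ≤ g := Nat.sInf_le (.inl rfl)
  refine ⟨fun z => sInf (A z), ?_, ?_, fun z w hzw hne => ?_⟩
  · exact Nat.eq_zero_of_le_zero (Nat.sInf_le (.inr ⟨.nil, rfl⟩))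
  · rcases hmem y with h1 | ⟨p, hp⟩
    · simp only [h1]
      omega
    · by_contra! hlt
      have hlen := p.length_bypass_le_length
      have hpath := p.bypass_isPath
      set p' := p.bypass
      have hadj' : ∀ i < p'.length, G'.Adj (p'.getVert i) (p'.getVert (i + 1)) :=
        fun i hi => p'.adj_getVert_succ hi
      have h0 := p'.getVert_zero
      have hl := p'.getVert_length
      have h2 : 2 ≤ p'.length := by
        by_contra! h2
        have : p'.length = 0 ∨ p'.length = 1 := by omega
        rcases this with h3 | h3
        · rw [h3, h0] at hl
          exact hxy.ne hl
        · have := hadj' 0 (by omega)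
          rw [h3] at hl
          rw [h0, zero_add, hl, hG', SimpleGraph.deleteEdges_adj] at this
          exact this.2 rfl
      refine h (p'.length + 1) (by omega) (by omega) p'.getVert
        (fun i hi j hj hij => hpath.getVert_injOn (Nat.lt_succ_iff.1 hi) (Nat.lt_succ_iff.1 hj) hij)
        fun i hi => ?_
      rcases Nat.lt_succ_iff_lt_or_eq.1 hi with hi' | rfl
      · rw [Nat.mod_eq_of_lt (by omega)]
        exact (SimpleGraph.deleteEdges_adj.1 (hadj' i hi')).1
      · rw [Nat.mod_self, h0, hl]
        exact hxy.symm
  · rcases hmem z with h1 | ⟨p, hp⟩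
    · have := hg w
      simp only [h1]
      omega
    · have hadj : G'.Adj z w := SimpleGraph.deleteEdges_adj.2 ⟨hzw, hne⟩
      exact Nat.sInf_le (.inr ⟨p.concat hadj, by rw [SimpleGraph.Walk.length_concat, hp]⟩)

theorem GirthGe.symm_function {G : SimpleGraph V} {x y : V} {g : ℕ}
    (h : ∃ φ : V → ℕ, φ x = 0 ∧ g ≤ φ y + 1 ∧
      ∀ z w, G.Adj z w → s(z, w) ≠ s(x, y) → φ w ≤ φ z + 1) :
    ∃ φ : V → ℕ, φ y = 0 ∧ g ≤ φ x + 1 ∧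
      ∀ z w, G.Adj z w → s(z, w) ≠ s(y, x) → φ w ≤ φ z + 1 := by
  obtain ⟨φ, h1, h2, h3⟩ := h
  refine ⟨fun z => φ y - φ z, by simp, by simpa [h1] using h2, fun z w hzw hne => ?_⟩
  have := h3 w z hzw.symm (by rwa [Sym2.eq_swap, Sym2.eq_swap (a := x)])
  simp only
  omega

theorem GirthGe.comap {G : SimpleGraph V} {G' : SimpleGraph W} {g : ℕ} (hG : GirthGe G g)
    (ι : W → V) (hι : Function.Injective ι) (h : ∀ x y, G'.Adj x y → G.Adj (ι x) (ι y)) :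
    GirthGe G' g := by
  intro x y hxy
  obtain ⟨φ, h1, h2, h3⟩ := hG _ _ (h _ _ hxy)
  refine ⟨φ ∘ ι, h1, h2, fun z w hzw hne => h3 _ _ (h _ _ hzw) fun he => hne ?_⟩
  exact Sym2.map.injective hι he

/-- Two ends `s₁`, `s₂` of half-edges at `B` are joined through a copy of `Q` that is opened along
the edge `ab`. -/
def cap (B : SimpleGraph V) (s₁ s₂ : V) (Q : SimpleGraph W) (a b : W) : SimpleGraph (V ⊕ W) where
  Adj
    | .inl x, .inl y => B.Adj x y
    | .inr x, .inr y => Q.Adj x y ∧ s(x, y) ≠ s(a, b)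
    | .inl x, .inr y => (x = s₁ ∧ y = a) ∨ (x = s₂ ∧ y = b)
    | .inr y, .inl x => (x = s₁ ∧ y = a) ∨ (x = s₂ ∧ y = b)
  symm := ⟨by
    rintro (x | x) (y | y) h
    · exact B.adj_symm h
    · exact h
    · exact h
    · exact ⟨Q.adj_symm h.1, by rw [Sym2.eq_swap]; exact h.2⟩⟩
  loopless := ⟨by
    rintro (x | x) h
    · exact B.loopless.irrefl x h
    · exact Q.loopless.irrefl x h.1⟩

section Cap

variable {B : SimpleGraph V} {s₁ s₂ : V} {Q : SimpleGraph W} {a b : W}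

@[simp] theorem cap_inl_inl {x y : V} : (cap B s₁ s₂ Q a b).Adj (.inl x) (.inl y) ↔ B.Adj x y :=
  Iff.rfl

@[simp] theorem cap_inr_inr {x y : W} :
    (cap B s₁ s₂ Q a b).Adj (.inr x) (.inr y) ↔ Q.Adj x y ∧ s(x, y) ≠ s(a, b) := Iff.rfl

@[simp] theorem cap_inl_inr {x : V} {y : W} :
    (cap B s₁ s₂ Q a b).Adj (.inl x) (.inr y) ↔ (x = s₁ ∧ y = a) ∨ (x = s₂ ∧ y = b) := Iff.rfl

@[simp] theorem cap_inr_inl {x : V} {y : W} :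
    (cap B s₁ s₂ Q a b).Adj (.inr y) (.inl x) ↔ (x = s₁ ∧ y = a) ∨ (x = s₂ ∧ y = b) := Iff.rfl

/-- A function that is Lipschitz along `B` extends to the cap, if the opened edge of `Q` is far
from being closed. -/
theorem exists_interpolation {g : ℕ} (hQ : GirthGe Q g) (hab : Q.Adj a b) (m n : ℕ)
    (hm : m + 1 ≤ g) (hn : n + 1 ≤ g) : ∃ ψ : W → ℕ, ψ a = m ∧ ψ b = n ∧
      ∀ z w, Q.Adj z w → s(z, w) ≠ s(a, b) → ψ w ≤ ψ z + 1 := by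
  have key : ∀ a b : W, Q.Adj a b → ∀ m n : ℕ, m ≤ n → n + 1 ≤ g → ∃ ψ : W → ℕ, ψ a = m ∧
      ψ b = n ∧ ∀ z w, Q.Adj z w → s(z, w) ≠ s(a, b) → ψ w ≤ ψ z + 1 := by
    intro a b hab m n hmn hn
    obtain ⟨φ, h1, h2, h3⟩ := hQ a b hab
    refine ⟨fun z => min (m + φ z) n, by simp [h1, hmn], ?_, fun z w hzw hne => ?_⟩
    · simp only
      omega
    · have := h3 z w hzw hne
      simp only
      omega
  rcases le_total m n with h | h
  · exact key a b hab m n h hn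
  · obtain ⟨ψ, h1, h2, h3⟩ := key b a hab.symm n m h hm
    exact ⟨ψ, h2, h1, fun z w hzw hne => h3 z w hzw (by rwa [Sym2.eq_swap (a := b)])⟩

/-- A passage through the opened copy of `Q` is as long as a path from `a` to `b` avoiding `ab`,
hence at least `g - 1`. In terms of certificates, functions on `B` are truncated at `g - 1` and
interpolated on `Q` between prescribed values at `a` and `b`. -/
theorem GirthGe.cap {g : ℕ} (hg : 1 ≤ g) (hB : GirthGe B g) (hQ : GirthGe Q g)
    (hab : Q.Adj a b) : GirthGe (cap B s₁ s₂ Q a b) g := by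
  have cross : ∀ x y, (GirthGraph.cap B s₁ s₂ Q a b).Adj (.inl x) (.inr y) →
      ∃ φ : V ⊕ W → ℕ, φ (.inl x) = 0 ∧ g ≤ φ (.inr y) + 1 ∧
      ∀ z w, (GirthGraph.cap B s₁ s₂ Q a b).Adj z w → s(z, w) ≠ s(.inl x, .inr y) →
        φ w ≤ φ z + 1 := by
    rintro x y (⟨rfl, rfl⟩ | ⟨rfl, rfl⟩)
    · obtain ⟨ψ, h1, h2, h3⟩ := exists_interpolation hQ hab (g - 1) 0 (by omega) (by omega)
      refine ⟨Sum.elim (fun _ => 0) ψ, rfl, by simp only [Sum.elim_inr]; omega, ?_⟩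
      rintro (z | z) (w | w) hzw hne
      · simp
      · rcases hzw with ⟨rfl, rfl⟩ | ⟨rfl, rfl⟩
        · exact absurd rfl hne
        · simp [h2]
      · simp
      · exact h3 _ _ hzw.1 hzw.2
    · obtain ⟨ψ, h1, h2, h3⟩ := exists_interpolation hQ hab 0 (g - 1) (by omega) (by omega)
      refine ⟨Sum.elim (fun _ => 0) ψ, rfl, by simp only [Sum.elim_inr]; omega, ?_⟩
      rintro (z | z) (w | w) hzw hne
      · simp
      · rcases hzw with ⟨rfl, rfl⟩ | ⟨rfl, rfl⟩
        · simp [h1]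
        · exact absurd rfl hne
      · simp
      · exact h3 _ _ hzw.1 hzw.2
  rintro (x | x) (y | y) hxy
  · obtain ⟨φ, h1, h2, h3⟩ := hB x y hxy
    obtain ⟨ψ, h4, h5, h6⟩ := exists_interpolation hQ hab (min (φ s₁) (g - 1)) (min (φ s₂) (g - 1))
      (by omega) (by omega)
    refine ⟨Sum.elim (fun z => min (φ z) (g - 1)) ψ, by simp [h1], ?_, ?_⟩
    · simp only [Sum.elim_inl]
      omega
    rintro (z | z) (w | w) hzw hne
    · have := h3 z w hzw (fun h => hne (congrArg (Sym2.map Sum.inl) h))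
      simp only [Sum.elim_inl]
      omega
    · rcases hzw with ⟨rfl, rfl⟩ | ⟨rfl, rfl⟩ <;> simp [h4, h5]
    · rcases hzw with ⟨rfl, rfl⟩ | ⟨rfl, rfl⟩ <;> simp only [Sum.elim_inl, Sum.elim_inr] <;> omega
    · exact h6 _ _ hzw.1 hzw.2
  · exact cross x y hxy
  · exact GirthGe.symm_function (cross y x hxy.symm)
  · obtain ⟨φ, h1, h2, h3⟩ := hQ x y hxy.1
    -- Although `ab` is missing in the cap, it is an edge of `Q`, so the certificate changes by at
    -- most one between `a` and `b`, and the constant `φ a` fits on `B`.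
    have hba := h3 _ _ hab hxy.2.symm
    have hab' := h3 _ _ hab.symm (by rw [Sym2.eq_swap]; exact hxy.2.symm)
    refine ⟨Sum.elim (fun _ => φ a) φ, h1, h2, ?_⟩
    rintro (z | z) (w | w) hzw hne
    · simp
    · rcases hzw with ⟨rfl, rfl⟩ | ⟨rfl, rfl⟩ <;> simp [hba]
    · rcases hzw with ⟨rfl, rfl⟩ | ⟨rfl, rfl⟩ <;> simp [hab']
    · exact h3 _ _ hzw.1 (fun h => hne (congrArg (Sym2.map Sum.inr) h))

variable [Fintype V] [Fintype W]

open Classical in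
theorem dg_cap_inl (hab : a ≠ b) (x : V) : dg (cap B s₁ s₂ Q a b) (.inl x) =
    dg B x + (if x = s₁ then 1 else 0) + (if x = s₂ then 1 else 0) := by
  rw [dg, Fintype.sum_sum_type, add_assoc, dg]
  refine congrArg₂ (· + ·) ?_ ?_
  · simp only [cap_inl_inl]
  · have h (y : W) : (if (cap B s₁ s₂ Q a b).Adj (.inl x) (.inr y) then 1 else 0) =
        (if y = a then (if x = s₁ then 1 else 0) else 0) +
        (if y = b then (if x = s₂ then 1 else 0) else 0) := by
      simp only [cap_inl_inr]
      by_cases h1 : y = a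
      · subst h1
        simp [hab]
      · by_cases h2 : y = b
        · subst h2
          simp [h1]
        · simp [h1, h2]
    rw [Finset.sum_congr rfl fun y _ => h y, Finset.sum_add_distrib]
    simp

open Classical in
theorem dg_cap_inr (hab : Q.Adj a b) (y : W) :
    dg (cap B s₁ s₂ Q a b) (.inr y) = dg Q y := by
  have h1 (z : W) : (if Q.Adj y z then 1 else 0) =
      (if (cap B s₁ s₂ Q a b).Adj (.inr y) (.inr z) then 1 else 0) +
      ((if z = b then (if y = a then 1 else 0) else 0) +
       (if z = a then (if y = b then 1 else 0) else 0)) := by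
    simp only [cap_inr_inr]
    have hne := hab.ne
    by_cases hya : y = a
    · subst hya
      by_cases hz : z = b
      · subst hz
        simp [hab, hne]
      · simp [hz, hne]
    · by_cases hyb : y = b
      · subst hyb
        by_cases hz : z = a
        · subst hz
          simp [hab.symm, hya]
        · simp [hz, hya]
      · simp [hya, hyb]
  have h2 (x : V) : (if (cap B s₁ s₂ Q a b).Adj (.inr y) (.inl x) then 1 else 0) =
      (if x = s₁ then (if y = a then 1 else 0) else 0) +
      (if x = s₂ then (if y = b then 1 else 0) else 0) := by
    simp only [cap_inr_inl]
    by_cases h1 : y = a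
    · subst h1
      simp [hab.ne]
    · simp [h1, ite_and]
  rw [dg, Fintype.sum_sum_type, Finset.sum_congr rfl fun x _ => h2 x, dg,
    Finset.sum_congr rfl fun z _ => h1 z, Finset.sum_add_distrib, Finset.sum_add_distrib,
    Finset.sum_add_distrib]
  simp
  omega

end Cap

end GirthGraph

/-! ### Components and completion to prescribed degrees -/

namespace GirthGraph

variable {V W : Type}

open Classical in
theorem dg_eq_card [Fintype V] (G : SimpleGraph V) (x : V) :
    dg G x = (Finset.univ.filter fun y => G.Adj x y).card := by
  simp [dg]

theorem dg_congr [Fintype V] [Fintype W] {G : SimpleGraph V} {G' : SimpleGraph W} (ι : W → V)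
    (hι : Function.Injective ι) (x : W) (h : ∀ y, G'.Adj x y ↔ G.Adj (ι x) (ι y))
    (h' : ∀ z, G.Adj (ι x) z → z ∈ Set.range ι) : dg G' x = dg G (ι x) := by
  classical
  rw [dg_eq_card, dg_eq_card]
  refine Finset.card_bij (fun y _ => ι y) (fun y hy => by simpa [h] using hy)
    (fun y _ z _ hyz => hι hyz) fun z hz => ?_
  obtain ⟨y, rfl⟩ := h' z (by simpa using hz)
  exact ⟨y, by simpa [h] using hz, rfl⟩

theorem even_sum_dg [Fintype V] (G : SimpleGraph V) : Even (∑ x, dg G x) := by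
  classical
  have h := G.sum_degrees_eq_twice_card_edges
  have h2 (x : V) : dg G x = G.degree x := by
    rw [dg_eq_card, ← SimpleGraph.card_neighborFinset_eq_degree]
    congr 1
    ext y
    simp
  rw [Finset.sum_congr rfl fun x _ => h2 x, h]
  exact even_two_mul _

/-- The connected component of a vertex. -/
theorem exists_component [Fintype V] (G : SimpleGraph V) (x : V) :
    ∃ (V' : Type) (_ : Fintype V') (G' : SimpleGraph V') (ι : V' → V),
      Function.Injective ι ∧ (∀ y z, G'.Adj y z ↔ G.Adj (ι y) (ι z)) ∧
      (∀ y, y ∈ Set.range ι ↔ G.Reachable x y) ∧ G'.Connected ∧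
      (∀ y, dg G' y = dg G (ι y)) ∧ Fintype.card V' ≤ Fintype.card V := by
  classical
  let C := G.connectedComponentMk x
  have hr (y : V) : y ∈ Set.range (Subtype.val : C → V) ↔ G.Reachable x y := by
    rw [Subtype.range_coe_subtype]
    change G.connectedComponentMk y = G.connectedComponentMk x ↔ _
    rw [SimpleGraph.ConnectedComponent.eq]
    exact ⟨fun h => h.symm, fun h => h.symm⟩
  refine ⟨C, Fintype.ofInjective (Subtype.val : C → V) Subtype.val_injective, C.toSimpleGraph,
    Subtype.val, Subtype.val_injective, fun y z => Iff.rfl, hr, C.connected_toSimpleGraph, ?_, ?_⟩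
  · intro y
    refine @dg_congr V C _ (_) _ _ _ Subtype.val_injective y (fun z => Iff.rfl) fun z hz => ?_
    exact (hr z).2 (((hr y.1).1 ⟨y, rfl⟩).trans hz.reachable)
  · exact @Fintype.card_le_of_injective C V (_) _ _ Subtype.val_injective

section Completion

variable {k g : ℕ} {H : SimpleGraph W} [Fintype W]

/-- `G'` contains `G`, the vertices of `G` get the additional degrees `D`, all other vertices have
degree `k`, and the labelling of the vertices of `G` extends to a Lipschitz labelling. -/
structure IsCompletion [Fintype V] (G : SimpleGraph V) (D lab : V → ℕ) (k g : ℕ) {V' : Type}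
    [Fintype V'] (G' : SimpleGraph V') (lab' : V' → ℕ) (ι : V → V') : Prop where
  injective : Function.Injective ι
  adj : ∀ x y, G.Adj x y → G'.Adj (ι x) (ι y)
  label : ∀ x, lab' (ι x) = lab x
  lipschitz : ∀ x y, G'.Adj x y → lab' y ≤ lab' x + 1
  degree : ∀ x, dg G' (ι x) = dg G x + D x
  degree_new : ∀ z, z ∉ Set.range ι → dg G' z = k
  girthGe : GirthGe G' g

/-- Two free half-edges at the same level are joined through a cap with a copy of `H`, not by an
edge, which could close a short cycle. The whole copy gets the label of that level, so the labelling
stays Lipschitz, and the number of free half-edges drops by two. -/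
theorem exists_completion_of_even (hg : 1 ≤ g) (hH : ∀ x, dg H x = k) (hHg : GirthGe H g)
    {a b : W} (hab : H.Adj a b) (n : ℕ) : ∀ (V : Type) [Fintype V] (G : SimpleGraph V)
    (D lab : V → ℕ), GirthGe G g → (∀ x y, G.Adj x y → lab y ≤ lab x + 1) → ∑ x, D x = n →
    (∀ t, Even (∑ x, if lab x = t then D x else 0)) →
    ∃ (V' : Type) (_ : Fintype V') (G' : SimpleGraph V') (lab' : V' → ℕ) (ι : V → V'),
      IsCompletion G D lab k g G' lab' ι ∧
      Fintype.card V' ≤ Fintype.card V + n * Fintype.card W := by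
  classical
  induction n using Nat.strong_induction_on with
  | _ n ih =>
  intro V _ G D lab hG hlab hD heven
  by_cases hn : n = 0
  · have hD0 : ∀ x, D x = 0 := by
      rw [hn, Finset.sum_eq_zero_iff] at hD
      exact fun x => hD x (Finset.mem_univ x)
    exact ⟨V, _, G, lab, id, ⟨Function.injective_id, fun _ _ h => h, fun _ => rfl, hlab,
      fun x => by simp [hD0], fun z hz => absurd ⟨z, rfl⟩ hz, hG⟩, by simp⟩
  obtain ⟨u, hu⟩ : ∃ u, 0 < D u := by
    by_contra! h
    exact hn (hD ▸ Finset.sum_eq_zero fun x _ => Nat.le_zero.1 (h x))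
  -- a second free half-edge at the same level
  obtain ⟨v, D', huv, hD'⟩ : ∃ v, ∃ D' : V → ℕ, lab v = lab u ∧
      ∀ x, D x = D' x + (if x = u then 1 else 0) + (if x = v then 1 else 0) := by
    by_cases h2 : 2 ≤ D u
    · refine ⟨u, fun x => if x = u then D u - 2 else D x, rfl, fun x => ?_⟩
      by_cases hx : x = u
      · subst hx
        simp only [if_true]
        omega
      · simp [hx]
    · obtain ⟨v, hvu, hv, hDv⟩ : ∃ v, v ≠ u ∧ lab v = lab u ∧ 0 < D v := by
        by_contra! h
        have h3 : ∑ x, (if lab x = lab u then D x else 0) = D u := by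
          rw [Finset.sum_eq_single u _ (by simp)]
          · simp
          · intro x _ hx
            split_ifs with h4
            · exact Nat.le_zero.1 (h x hx h4)
            · rfl
        have := heven (lab u)
        rw [h3, show D u = 1 by omega] at this
        exact absurd this (by decide)
      refine ⟨v, fun x => D x - ((if x = u then 1 else 0) + (if x = v then 1 else 0)), hv,
        fun x => ?_⟩
      by_cases hx : x = u
      · subst hx
        have : x ≠ v := hvu.symm
        simp only [if_true, if_neg this]
        omega
      · by_cases hxv : x = v
        · subst hxv
          simp only [if_true, if_neg hx]
          omega
        · simp [hx, hxv]
  have hsum : ∑ x, D' x + 2 = n := by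
    rw [← hD, Finset.sum_congr rfl fun x _ => hD' x, Finset.sum_add_distrib,
      Finset.sum_add_distrib]
    simp
  obtain ⟨V', _, G', lab', ι, hc, hcard⟩ := ih (n - 2) (by omega) (V ⊕ W) (cap G u v H a b)
    (Sum.elim D' fun _ => 0) (Sum.elim lab fun _ => lab u) (hG.cap hg hHg hab) (by
      rintro (x | x) (y | y) hxy
      · exact hlab x y hxy
      · rcases hxy with ⟨rfl, rfl⟩ | ⟨rfl, rfl⟩ <;> simp [huv]
      · rcases hxy with ⟨rfl, rfl⟩ | ⟨rfl, rfl⟩ <;> simp [huv]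
      · simp) (by simp; omega) (by
      intro t
      have h1 := heven t
      have h2 : ∑ x, (if lab x = t then D x else 0) =
          (∑ x, if lab x = t then D' x else 0) + 2 * (if lab u = t then 1 else 0) := by
        have h3 (x : V) : (if lab x = t then D x else 0) = (if lab x = t then D' x else 0) +
            (if x = u then (if lab u = t then 1 else 0) else 0) +
            (if x = v then (if lab u = t then 1 else 0) else 0) := by
          rw [hD' x]
          by_cases hxu : x = u
          · subst hxu
            by_cases ht : lab x = t <;> simp [ht]
          · by_cases hxv : x = v
            · subst hxv
              rw [huv]
              by_cases ht : lab u = t <;> simp [ht, hxu]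
            · simp [hxu, hxv]
        rw [Finset.sum_congr rfl fun x _ => h3 x, Finset.sum_add_distrib, Finset.sum_add_distrib]
        simp [mul_comm, add_assoc, ← two_mul]
      rw [h2] at h1
      have h4 := (Nat.even_add.1 h1).2 (even_two_mul _)
      rw [Fintype.sum_sum_type]
      change Even ((∑ x, if lab x = t then D' x else 0) + ∑ _ : W, if lab u = t then 0 else 0)
      simpa using h4)
  refine ⟨V', _, G', lab', ι ∘ Sum.inl, ⟨hc.injective.comp Sum.inl_injective,
    fun x y h => hc.adj _ _ h, fun x => hc.label _, hc.lipschitz, fun x => ?_, fun z hz => ?_,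
    hc.girthGe⟩, ?_⟩
  · rw [Function.comp_apply, hc.degree, dg_cap_inl hab.ne, hD' x]
    simp only [Sum.elim_inl]
    ring
  · by_cases hz' : z ∈ Set.range ι
    · obtain ⟨x | x, rfl⟩ := hz'
      · exact absurd ⟨x, rfl⟩ hz
      · rw [hc.degree, dg_cap_inr hab, hH]
        simp
    · exact hc.degree_new z hz'
  · rw [Fintype.card_sum] at hcard
    obtain ⟨m, rfl⟩ : ∃ m, n = m + 2 := ⟨n - 2, by omega⟩
    rw [Nat.add_sub_cancel] at hcard
    nlinarith [Nat.zero_le (Fintype.card W)]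

/-- Completion of a graph to one with prescribed degrees; if `k` is odd, isolated vertices are added
first at the levels with an odd number of free half-edges. -/
theorem exists_completion (hg : 1 ≤ g) (hH : ∀ x, dg H x = k) (hHg : GirthGe H g)
    {a b : W} (hab : H.Adj a b) [Fintype V] (G : SimpleGraph V) (D lab : V → ℕ)
    (hG : GirthGe G g) (hlab : ∀ x y, G.Adj x y → lab y ≤ lab x + 1)
    (heven : Even k → ∀ t, Even (∑ x, if lab x = t then D x else 0)) :
    ∃ (V' : Type) (_ : Fintype V') (G' : SimpleGraph V') (lab' : V' → ℕ) (ι : V → V'),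
      IsCompletion G D lab k g G' lab' ι ∧
      Fintype.card V' ≤ Fintype.card V +
        (∑ x, D x) * (1 + (1 + k) * Fintype.card W) := by
  classical
  by_cases hk : Even k
  · obtain ⟨V', i, G', lab', ι, hc, hcard⟩ :=
      exists_completion_of_even hg hH hHg hab _ V G D lab hG hlab rfl (heven hk)
    refine ⟨V', i, G', lab', ι, hc, hcard.trans ?_⟩
    have : (∑ x, D x) * Fintype.card W ≤ (∑ x, D x) * (1 + (1 + k) * Fintype.card W) :=
      Nat.mul_le_mul_left _ (by nlinarith [Nat.zero_le (k * Fintype.card W)])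
    omega
  let O : Finset ℕ := (Finset.univ.image lab).filter fun t =>
    ¬ Even (∑ x, if lab x = t then D x else 0)
  have hO : O.card ≤ ∑ x, D x := by
    calc O.card = ∑ t ∈ O, 1 := by simp
      _ ≤ ∑ t ∈ O, ∑ x, (if lab x = t then D x else 0) := Finset.sum_le_sum fun t ht => by
          have := (Finset.mem_filter.1 ht).2
          by_contra h
          exact this (by rw [Nat.lt_one_iff.1 (not_le.1 h)]; exact Even.zero)
      _ = ∑ x, ∑ t ∈ O, (if lab x = t then D x else 0) := Finset.sum_comm
      _ ≤ ∑ x, D x := Finset.sum_le_sum fun x _ => by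
          rw [Finset.sum_ite_eq]
          split_ifs <;> simp
  obtain ⟨V', i, G', lab', ι, hc, hcard⟩ := exists_completion_of_even hg hH hHg hab _ (V ⊕ O)
    (G ⊕g (⊥ : SimpleGraph O)) (Sum.elim D fun _ => k) (Sum.elim lab Subtype.val) (by
      rintro (x | x) (y | y) hxy
      · obtain ⟨φ, h1, h2, h3⟩ := hG x y (by simpa using hxy)
        refine ⟨Sum.elim φ fun _ => 0, h1, h2, ?_⟩
        rintro (z | z) (w | w) hzw hne
        · exact h3 z w (by simpa using hzw) fun h => hne (congrArg (Sym2.map Sum.inl) h)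
        all_goals simp at hzw
      all_goals simp at hxy) (by
      rintro (x | x) (y | y) hxy
      · exact hlab x y (by simpa using hxy)
      all_goals simp at hxy) rfl (by
      intro t
      rw [Fintype.sum_sum_type]
      change Even ((∑ x, if lab x = t then D x else 0) + ∑ x : O, if (x : ℕ) = t then k else 0)
      rw [Finset.sum_coe_sort O fun s => if s = t then k else 0, Finset.sum_ite_eq']
      by_cases ht : t ∈ O
      · rw [if_pos ht]
        exact (Nat.not_even_iff_odd.1 (Finset.mem_filter.1 ht).2).add_odd
          (Nat.not_even_iff_odd.1 hk)
      · rw [if_neg ht, add_zero]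
        by_contra h
        refine ht (Finset.mem_filter.2 ⟨?_, h⟩)
        by_contra ht'
        refine h ?_
        rw [Finset.sum_eq_zero]
        · exact Even.zero
        · intro x _
          rw [if_neg]
          rintro rfl
          exact ht' (Finset.mem_image_of_mem _ (Finset.mem_univ x)))
  have hdl (x : V) : dg (G ⊕g (⊥ : SimpleGraph O)) (.inl x) = dg G x := by
    rw [dg, Fintype.sum_sum_type]
    simp [dg]
  have hdr (x : O) : dg (G ⊕g (⊥ : SimpleGraph O)) (.inr x) = 0 := by
    rw [dg, Fintype.sum_sum_type]
    simp
  refine ⟨V', i, G', lab', ι ∘ Sum.inl, ⟨hc.injective.comp Sum.inl_injective,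
    fun x y h => hc.adj _ _ (by simpa using h), fun x => hc.label _, hc.lipschitz, fun x => ?_,
    fun z hz => ?_, hc.girthGe⟩, ?_⟩
  · rw [Function.comp_apply, hc.degree, hdl]
    rfl
  · by_cases hz' : z ∈ Set.range ι
    · obtain ⟨x | x, rfl⟩ := hz'
      · exact absurd ⟨x, rfl⟩ hz
      · rw [hc.degree, hdr]
        simp
    · exact hc.degree_new z hz'
  · refine hcard.trans ?_
    rw [Fintype.card_sum, Fintype.sum_sum_type]
    simp only [Sum.elim_inl, Sum.elim_inr, Finset.sum_const, Finset.card_univ, Fintype.card_coe,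
      smul_eq_mul]
    have h1 : O.card * k * Fintype.card W ≤ (∑ x, D x) * k * Fintype.card W := by gcongr
    nlinarith

end Completion

end GirthGraph

/-! ### Regular graphs of large girth as Cayley graphs -/

namespace RegularGraph

open GirthGraph

/-- The words of length at most `r` in `k` letters without equal consecutive letters: the vertices
of a ball in the `k`-regular tree. -/
abbrev Ball (k r : ℕ) : Type := {l : List (Fin k) // l.IsChain (· ≠ ·) ∧ l.length ≤ r}

instance (k r : ℕ) : Finite (Ball k r) :=
  Set.Finite.to_subtype ((List.finite_length_le (Fin k) r).subset fun _ h => h.2)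

/-- Reflection of the ball along the edges of one colour. -/
def flip {k r : ℕ} (c : Fin k) (l : Ball k r) : Ball k r :=
  match l with
  | ⟨[], h⟩ => if h0 : 0 < r then ⟨[c], by simp, h0⟩ else ⟨[], h⟩
  | ⟨b :: t, h⟩ =>
    if hb : b = c then ⟨t, h.1.tail, (Nat.le_succ _).trans h.2⟩
    else if hl : t.length + 1 < r then ⟨c :: b :: t, h.1.cons_cons (Ne.symm hb), hl⟩
    else ⟨b :: t, h⟩

theorem flip_flip {k r : ℕ} (c : Fin k) (l : Ball k r) : flip c (flip c l) = l := by
  obtain ⟨_ | ⟨b, t⟩, h⟩ := l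
  · by_cases h0 : 0 < r
    · simp [flip, h0]
    · simp [flip, h0]
  · by_cases hb : b = c
    · subst hb
      obtain _ | ⟨b', t⟩ := t
      · have h0 : 0 < r := h.2
        simp [flip, h0]
      · have hne : b' ≠ b := by
          have := h.1
          simp only [List.isChain_cons_cons] at this
          exact this.1.symm
        have hl : t.length + 1 < r := h.2
        simp [flip, hne, hl]
    · by_cases hl : t.length + 1 < r
      · simp [flip, hb, hl]
      · simp [flip, hb, hl]

/-- Reflection as a permutation. -/
def flipPerm {k r : ℕ} (c : Fin k) : Equiv.Perm (Ball k r) :=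
  ⟨flip c, flip c, flip_flip c, flip_flip c⟩

theorem flipPerm_mul_self {k r : ℕ} (c : Fin k) : flipPerm (r := r) c * flipPerm c = 1 :=
  Equiv.ext fun l => flip_flip c l

/-- The empty word. -/
def center (k r : ℕ) : Ball k r := ⟨[], by simp⟩

theorem flip_of_head_ne {k r : ℕ} (c : Fin k) (l : Ball k r) (h : ∀ b ∈ l.1.head?, b ≠ c)
    (hl : l.1.length < r) : (flip c l).1 = c :: l.1 := by
  obtain ⟨_ | ⟨b, t⟩, h'⟩ := l
  · have h0 : 0 < r := hl
    simp [flip, h0]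
  · have hb : b ≠ c := h b (by simp)
    have hl' : t.length + 1 < r := hl
    simp [flip, hb, hl']

theorem flipPerm_injective {k r : ℕ} (hr : 0 < r) :
    Function.Injective (flipPerm : Fin k → Equiv.Perm (Ball k r)) := by
  intro c c' h
  have h1 : flip c (center k r) = flip c' (center k r) := DFunLike.congr_fun h (center k r)
  have h2 := congrArg Subtype.val h1
  rw [flip_of_head_ne c _ (by simp [center]) (by simpa [center]),
    flip_of_head_ne c' _ (by simp [center]) (by simpa [center])] at h2
  simpa using h2

theorem flipPerm_ne_one {k r : ℕ} (hr : 0 < r) (c : Fin k) :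
    (flipPerm c : Equiv.Perm (Ball k r)) ≠ 1 := by
  intro h
  have h1 : flip c (center k r) = center k r := DFunLike.congr_fun h (center k r)
  have h2 := congrArg Subtype.val h1
  rw [flip_of_head_ne c _ (by simp [center]) (by simpa [center])] at h2
  simp [center] at h2

/-- The Cayley graph of the permutations of the ball with respect to the reflections. -/
def cayley (k r : ℕ) (hr : 0 < r) : SimpleGraph (Equiv.Perm (Ball k r)) where
  Adj σ τ := ∃ c, τ = flipPerm c * σ
  symm := ⟨by
    rintro σ _ ⟨c, rfl⟩
    exact ⟨c, by rw [← mul_assoc, flipPerm_mul_self, one_mul]⟩⟩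
  loopless := ⟨by
    rintro σ ⟨c, h⟩
    exact flipPerm_ne_one hr c (mul_eq_right.1 h.symm)⟩

/-- A closed walk of length `n < r` without backtracking is a product of reflections, consecutive
ones distinct, that equals the identity. But applied to the centre of the ball, each reflection
lengthens the word by one letter. -/
theorem girthGe_cayley (k r : ℕ) (hr : 0 < r) : GirthGe (cayley k r hr) r := by
  refine girthGe_of_not_cyclic fun n hn hnr q hq hadj => ?_
  choose c hc using hadj
  -- Equal consecutive colours would return to the same vertex after two steps, but `n ≥ 3`.
  have hne : ∀ i (hi : i + 1 < n), c i (by omega) ≠ c (i + 1) hi := by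
    intro i hi heq
    have h1 := hc i (by omega)
    have h2 := hc (i + 1) hi
    rw [Nat.mod_eq_of_lt hi] at h1
    rw [h1, ← heq, ← mul_assoc, flipPerm_mul_self, one_mul] at h2
    have h3 := hq (show (i + 1 + 1) % n < n from Nat.mod_lt _ (by omega)) (show i < n by omega) h2
    rcases (show i + 1 + 1 < n ∨ i + 1 + 1 = n by omega) with h4 | h4
    · rw [Nat.mod_eq_of_lt h4] at h3
      omega
    · rw [h4, Nat.mod_self] at h3
      omega
  -- The orbit of the centre along the walk; `ρ i` turns out to have length `i`.
  let ρ (i : ℕ) : Ball k r := (q i * (q 0)⁻¹) (center k r)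
  have hρ : ∀ i (hi : i < n), ρ ((i + 1) % n) = flip (c i hi) (ρ i) := by
    intro i hi
    change (q ((i + 1) % n) * (q 0)⁻¹) _ = _
    rw [hc i hi, mul_assoc]
    rfl
  have hρ0 : ρ 0 = center k r := by simp [ρ]
  have key : ∀ i (hi : i < n), (ρ i).1.length = i ∧ ∀ b ∈ (ρ i).1.head?, b ≠ c i hi := by
    intro i
    induction i with
    | zero =>
      intro hi
      rw [hρ0]
      simp [center]
    | succ i ih =>
      intro hi
      obtain ⟨h1, h2⟩ := ih (by omega)
      have h3 := hρ i (by omega)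
      rw [Nat.mod_eq_of_lt hi] at h3
      rw [h3, flip_of_head_ne _ _ h2 (by omega)]
      refine ⟨by simp [h1], ?_⟩
      simp only [List.head?_cons, Option.mem_def, Option.some.injEq]
      rintro _ rfl
      exact hne i hi
  obtain ⟨h1, h2⟩ := key (n - 1) (by omega)
  have h3 := hρ (n - 1) (by omega)
  rw [Nat.sub_add_cancel (by omega), Nat.mod_self, hρ0] at h3
  have h4 := congrArg (fun l => l.1.length) h3
  simp only [flip_of_head_ne _ _ h2 (by omega : (ρ (n - 1)).1.length < r)] at h4
  simp [center] at h4

/-- There are finite `k`-regular graphs without cycles shorter than `g`. -/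
theorem exists_regular (k g : ℕ) (hk : 1 ≤ k) (hg : 1 ≤ g) :
    ∃ (W : Type) (_ : Fintype W) (H : SimpleGraph W) (a b : W), H.Adj a b ∧
      (∀ x, dg H x = k) ∧ GirthGe H g := by
  classical
  have := Fintype.ofFinite (Ball k g)
  refine ⟨Equiv.Perm (Ball k g), inferInstance, cayley k g hg, 1, flipPerm ⟨0, hk⟩ * 1,
    ⟨_, rfl⟩, fun σ => ?_, girthGe_cayley k g hg⟩
  rw [dg_eq_card]
  have h : (Finset.univ.filter fun τ => (cayley k g hg).Adj σ τ) =
      Finset.univ.image fun c : Fin k => flipPerm c * σ := by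
    ext τ
    rw [Finset.mem_filter, Finset.mem_image]
    exact ⟨fun ⟨_, c, hc⟩ => ⟨c, Finset.mem_univ _, hc.symm⟩,
      fun ⟨c, _, hc⟩ => ⟨Finset.mem_univ _, c, hc.symm⟩⟩
  rw [h, Finset.card_image_of_injective _
    (fun c c' hcc => flipPerm_injective hg (mul_right_cancel hcc))]
  simp

end RegularGraph

/-! ### From graphs to words: breadth-first search -/

namespace LayerWord

open SlidingWord GirthGraph

theorem exists_bits (n : ℕ) (C : ℕ → Prop) : ∃ e < 2 ^ n, ∀ j < n, HasBit e j ↔ C j := by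
  classical
  refine ⟨Nat.ofBits fun j : Fin n => decide (C j), Nat.ofBits_lt_two_pow _, fun j hj => ?_⟩
  have h := Nat.testBit_ofBits_lt (fun j : Fin n => decide (C j)) j hj
  rw [Nat.testBit_eq_decide_div_mod_eq] at h
  simpa [HasBit] using h

variable {V : Type}

theorem dist_le_succ {G : SimpleGraph V} (hG : G.Connected) (x : V) {y z : V} (h : G.Adj y z) :
    G.dist x z ≤ G.dist x y + 1 := by
  have := hG.dist_triangle (u := x) (v := y) (w := z)
  rwa [SimpleGraph.dist_eq_one_iff_adj.2 h] at this

theorem exists_adj_dist {G : SimpleGraph V} (hG : G.Connected) (x : V) {z : V} {n : ℕ}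
    (h : G.dist x z = n + 1) : ∃ y, G.Adj y z ∧ G.dist x y = n := by
  obtain ⟨p, hp⟩ := hG.exists_walk_length_eq_dist x z
  have hn : ¬ p.Nil := by
    intro hn
    have := SimpleGraph.Walk.length_eq_zero_iff.2 hn
    omega
  refine ⟨p.penultimate, p.adj_penultimate hn, ?_⟩
  have h1 : G.dist x p.penultimate ≤ p.dropLast.length := SimpleGraph.dist_le _
  have h2 := dist_le_succ hG x (p.adj_penultimate hn)
  have h3 : p.dropLast.length = p.length - 1 := by simp
  omega

theorem exists_dist_eq {G : SimpleGraph V} (hG : G.Connected) (x : V) {z : V} (n : ℕ)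
    (h : n ≤ G.dist x z) : ∃ y, G.dist x y = n := by
  obtain ⟨m, hm⟩ := Nat.exists_eq_add_of_le h
  induction m generalizing z with
  | zero => exact ⟨z, hm⟩
  | succ m ih =>
    obtain ⟨y, -, hy⟩ := exists_adj_dist hG x (n := n + m) hm
    exact ih (by omega) hy

theorem exists_numbering [Fintype V] (x₀ : V) (f : V → ℕ) : ∃ (a : ℕ → ℕ) (vt : ℕ → ℕ → V) (num : V → ℕ),
    (∀ v, num v < a (f v) ∧ vt (f v) (num v) = v) ∧
    (∀ i m, m < a i → f (vt i m) = i ∧ num (vt i m) = m) := by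
  classical
  let L (i : ℕ) : Finset V := Finset.univ.filter fun v => f v = i
  have hL (v : V) : v ∈ L (f v) := by simp [L]
  refine ⟨fun i => (L i).card,
    fun i m => if h : m < (L i).card then ((L i).equivFin.symm ⟨m, h⟩ : V) else x₀,
    fun v => (L (f v)).equivFin ⟨v, hL v⟩, fun v => ⟨Fin.is_lt _, ?_⟩, fun i m hm => ?_⟩
  · simp
  · have hm : m < (L i).card := hm
    have h1 : f ((L i).equivFin.symm ⟨m, hm⟩ : V) = i :=
      (Finset.mem_filter.1 ((L i).equivFin.symm ⟨m, hm⟩).2).2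
    have key : ∀ j (hj : (((L i).equivFin.symm ⟨m, hm⟩ : L i) : V) ∈ L j), j = i →
        ((L j).equivFin ⟨((L i).equivFin.symm ⟨m, hm⟩ : L i), hj⟩ : ℕ) = m := by
      rintro j hj rfl
      simp
    have key' : ∀ v : V, v = ((L i).equivFin.symm ⟨m, hm⟩ : V) →
        f v = i ∧ ((L (f v)).equivFin ⟨v, hL v⟩ : ℕ) = m := by
      rintro v rfl
      exact ⟨h1, key _ _ h1⟩
    exact key' _ (dif_pos hm)

/-- The sum over one layer. -/
theorem sum_layer [Fintype V] {f : V → ℕ} {a : ℕ → ℕ} {vt : ℕ → ℕ → V} {num : V → ℕ}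
    (h1 : ∀ v, num v < a (f v) ∧ vt (f v) (num v) = v)
    (h2 : ∀ i m, m < a i → f (vt i m) = i ∧ num (vt i m) = m) (F : V → ℕ) (i : ℕ) :
    ∑ m ∈ Finset.range (a i), F (vt i m) = ∑ v, if f v = i then F v else 0 := by
  classical
  rw [← Finset.sum_filter]
  refine Finset.sum_nbij' (vt i) num (fun m hm => ?_) (fun v hv => ?_) (fun m hm => ?_)
    (fun v hv => ?_) fun _ _ => rfl
  · simpa using (h2 i m (Finset.mem_range.1 hm)).1
  · rw [← (Finset.mem_filter.1 hv).2]
    exact Finset.mem_range.2 (h1 v).1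
  · exact (h2 i m (Finset.mem_range.1 hm)).2
  · rw [← (Finset.mem_filter.1 hv).2]
    exact (h1 v).2

open Classical in
/-- In a graph with even degrees, the cut between two consecutive levels is even. -/
theorem even_cut [Fintype V] {G : SimpleGraph V} {f : V → ℕ}
    (hf : ∀ y z, G.Adj y z → f z ≤ f y + 1) (J : ℕ) (hd : ∀ v, f v ≤ J → Even (dg G v)) :
    Even (∑ v, if f v = J then (∑ w, if f w = J + 1 then (if G.Adj v w then 1 else 0) else 0)
      else 0) := by
  have h1 : Even (∑ v, if f v ≤ J then dg G v else 0) :=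
    Finset.even_sum _ fun v _ => by
      split_ifs with h
      · exact hd v h
      · exact Even.zero
  -- The degree sum over the levels up to `J` counts the edges inside them twice and the edges of
  -- the cut once; handshaking in `A` settles the former.
  let A : SimpleGraph V := SimpleGraph.mk (fun v w => G.Adj v w ∧ f v ≤ J ∧ f w ≤ J)
    ⟨fun v w h => ⟨h.1.symm, h.2.2, h.2.1⟩⟩ ⟨fun v h => G.loopless.irrefl v h.1⟩
  have h2 := even_sum_dg A
  have h3 : ∑ v, (if f v ≤ J then dg G v else 0) = ∑ v, dg A v +
      ∑ v, if f v = J then (∑ w, if f w = J + 1 then (if G.Adj v w then 1 else 0) else 0)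
      else 0 := by
    rw [← Finset.sum_add_distrib]
    refine Finset.sum_congr rfl fun v _ => ?_
    have h4 : (if f v = J then (∑ w, if f w = J + 1 then (if G.Adj v w then 1 else 0) else 0)
      else 0) = ∑ w, if f v = J ∧ f w = J + 1 ∧ G.Adj v w then 1 else 0 := by
      by_cases hv : f v = J
      · rw [if_pos hv]
        refine Finset.sum_congr rfl fun w _ => ?_
        by_cases hw : f w = J + 1 <;> simp [hv, hw]
      · simp [hv]
    rw [h4, dg, dg, ← Finset.sum_add_distrib]
    by_cases hv : f v ≤ J
    · rw [if_pos hv]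
      refine Finset.sum_congr rfl fun w _ => ?_
      by_cases hvw : G.Adj v w
      · have h5 := hf v w hvw
        by_cases hw : f w ≤ J
        · have : f w ≠ J + 1 := by omega
          simp [A, hvw, hv, hw, this]
        · have h6 : f w = J + 1 := by omega
          have h7 : f v = J := by omega
          simp [A, hvw, h6, h7]
      · simp [A, hvw]
    · have : f v ≠ J := by omega
      simp [A, hv, this]
  rw [h3] at h1
  exact (Nat.even_add.1 h1).1 h2

/-- Breadth-first search turns a graph with one exceptional vertex into a legal word. -/
theorem exists_legal_word {k g : ℕ} (hg : 1 ≤ g) [Fintype V] {G : SimpleGraph V}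
    (hG : G.Connected) (hgirth : GirthGe G g) (x : V) (hdeg : ∀ y, y ≠ x → dg G y = k)
    (hx : Even k → Even (dg G x)) (z : V) :
    ∃ s : ℕ → ℕ × ℕ, Legal (Window k g) (2 * g) s (G.dist x z + 1) ∧
      ∑ i ∈ Finset.range (G.dist x z + 1), (s i).1 ≤ Fintype.card V := by
  classical
  obtain ⟨a, vt, num, h1, h2⟩ := exists_numbering x fun v => G.dist x v
  have hbits (i : ℕ) := exists_bits (digits (max (a i) (a (i + 1)))) fun j =>
    ∃ m n, m < a i ∧ ((n < a i ∧ j = 2 * Nat.pair m n ∧ G.Adj (vt i m) (vt i n)) ∨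
      (n < a (i + 1) ∧ j = 2 * Nat.pair m n + 1 ∧ G.Adj (vt i m) (vt (i + 1) n)))
  choose e he hbit using hbits
  let s (i : ℕ) : ℕ × ℕ := (a i, e i)
  have hinner : ∀ i m n, m < a i → n < a i → (Inner (s i) m n ↔ G.Adj (vt i m) (vt i n)) := by
    intro i m n hm hn
    have hlt := pair_lt_digits (hm.le.trans (le_max_left (a i) (a (i + 1))))
      (hn.le.trans (le_max_left (a i) (a (i + 1))))
    rw [Inner, hbit i _ (by omega)]
    refine ⟨?_, fun h => ⟨m, n, hm, .inl ⟨hn, rfl, h⟩⟩⟩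
    rintro ⟨m', n', -, ⟨-, h3, h4⟩ | ⟨-, h3, -⟩⟩
    · obtain ⟨rfl, rfl⟩ := Nat.pair_eq_pair.1 (by omega : Nat.pair m n = Nat.pair m' n')
      exact h4
    · omega
  have houter : ∀ i m n, m < a i → n < a (i + 1) →
      (Outer (s i) m n ↔ G.Adj (vt i m) (vt (i + 1) n)) := by
    intro i m n hm hn
    have hlt := pair_lt_digits (hm.le.trans (le_max_left (a i) (a (i + 1))))
      (hn.le.trans (le_max_right (a i) (a (i + 1))))
    rw [Outer, hbit i _ (by omega)]
    refine ⟨?_, fun h => ⟨m, n, hm, .inr ⟨hn, rfl, h⟩⟩⟩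
    rintro ⟨m', n', -, ⟨-, h3, -⟩ | ⟨-, h3, h4⟩⟩
    · omega
    · obtain ⟨rfl, rfl⟩ := Nat.pair_eq_pair.1 (by omega : Nat.pair m n = Nat.pair m' n')
      exact h4
  have hadj : ∀ i m j n, m < a i → n < a j →
      (WAdj s (i, m) (j, n) ↔ G.Adj (vt i m) (vt j n)) := by
    intro i m j n hm hn
    have hi := (h2 i m hm).1
    have hj := (h2 j n hn).1
    constructor
    · rintro (⟨h3, -, h5⟩ | ⟨h3, h4⟩ | ⟨h3, h4⟩)
      · obtain rfl : i = j := h3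
        rcases h5 with h5 | h5
        · exact (hinner i m n hm hn).1 h5
        · exact ((hinner i n m hn hm).1 h5).symm
      · obtain rfl : j = i + 1 := h3
        exact (houter i m n hm hn).1 h4
      · obtain rfl : i = j + 1 := h3
        exact ((houter j n m hn hm).1 h4).symm
    · intro h
      have h3 := dist_le_succ hG x h
      have h4 := dist_le_succ hG x h.symm
      simp only [hi, hj] at h3 h4 ⊢
      rcases (by omega : i = j ∨ j = i + 1 ∨ i = j + 1) with rfl | rfl | rfl
      · refine .inl ⟨rfl, ?_, .inl ((hinner i m n hm hn).2 h)⟩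
        rintro rfl
        exact h.ne rfl
      · exact .inr (.inl ⟨rfl, (houter i m n hm hn).2 h⟩)
      · exact .inr (.inr ⟨rfl, (houter j n m hn hm).2 h.symm⟩)
  have hpos : ∀ i ≤ G.dist x z, 0 < a i := by
    intro i hi
    obtain ⟨y, hy⟩ := exists_dist_eq hG x i hi
    have := (h1 y).1
    simp only [hy] at this
    omega
  refine ⟨s, fun i hi => ⟨fun t _ => he (i + t), hpos _ (by omega), fun m hm => ?_,
    fun m hm => ?_, fun hk => ?_, fun l hl3 hlg hl hnd hcyc => ?_⟩, ?_⟩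
  · -- degrees
    have hm : m < a (i + g) := hm
    have hv := (h2 (i + g) m hm).1
    -- The central layer of a window has distance at least `g ≥ 1` from `x`, so the exceptional
    -- degree is never tested.
    have hne : vt (i + g) m ≠ x := by
      intro h
      rw [h, SimpleGraph.dist_self] at hv
      omega
    have h3 : ∀ t, ∑ y ∈ Finset.range (a (i + (g - 1 + t))),
        (if WAdj (fun t => s (i + t)) (g, m) (g - 1 + t, y) then 1 else 0) =
        ∑ v, if G.dist x v = i + (g - 1 + t) then
          (if G.Adj (vt (i + g) m) v then 1 else 0) else 0 := by
      intro t
      rw [← sum_layer h1 h2 (fun v => if G.Adj (vt (i + g) m) v then 1 else 0)]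
      refine Finset.sum_congr rfl fun y hy => ?_
      simp only [wadj_shift, hadj _ _ _ _ hm (Finset.mem_range.1 hy)]
    rw [Finset.sum_congr rfl fun t _ => h3 t, Finset.sum_comm, ← hdeg _ hne, dg]
    refine Finset.sum_congr rfl fun v _ => ?_
    by_cases hav : G.Adj (vt (i + g) m) v
    · have h4 := dist_le_succ hG x hav
      have h5 := dist_le_succ hG x hav.symm
      rw [hv] at h4 h5
      simp only [hav, if_true, Finset.sum_range_succ, Finset.sum_range_zero]
      rcases (by omega : G.dist x v = i + (g - 1) ∨ G.dist x v = i + (g - 1 + 1) ∨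
        G.dist x v = i + (g - 1 + 2)) with h | h | h <;> rw [h] <;> simp
    · simp [hav]
  · -- backward neighbours
    have hm : m < a (i + g) := hm
    have hv := (h2 (i + g) m hm).1
    obtain ⟨y, hy, hdy⟩ := exists_adj_dist hG x (n := i + (g - 1)) (by rw [hv]; omega)
    have h3 := h1 y
    simp only [hdy] at h3
    refine ⟨num y, h3.1, ?_⟩
    refine (houter (i + (g - 1)) _ _ h3.1 ?_).2 ?_
    · rwa [show i + (g - 1) + 1 = i + g by omega]
    · rw [h3.2, show i + (g - 1) + 1 = i + g by omega]
      exact hy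
  · -- cuts
    have hke : Even k := Nat.even_iff.2 hk
    have h3 := even_cut (fun y z h => dist_le_succ hG x h) (i + g) fun v _ => by
      by_cases hvx : v = x
      · rw [hvx]
        exact hx hke
      · rw [hdeg v hvx]
        exact hke
    rw [← Nat.even_iff]
    convert h3 using 1
    rw [← sum_layer h1 h2]
    refine Finset.sum_congr rfl fun m hm => ?_
    rw [← sum_layer h1 h2]
    refine Finset.sum_congr rfl fun n hn => ?_
    simp only [houter _ _ _ (Finset.mem_range.1 hm) (Finset.mem_range.1 hn)]
  · -- short cycles
    let q (n : ℕ) : V := vt (i + (l.getD n (0, 0)).1) (l.getD n (0, 0)).2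
    have hmem : ∀ n < l.length, l.getD n (0, 0) ∈ l := fun n hn => by
      rw [List.getD_eq_getElem _ _ hn]
      exact List.getElem_mem hn
    have hlt : ∀ n < l.length, (l.getD n (0, 0)).2 < a (i + (l.getD n (0, 0)).1) :=
      fun n hn => (hl _ (hmem n hn)).2
    refine absurd (hgirth.le_of_cyclic hl3 (q := q) (fun n hn n' hn' h => ?_) fun n hn => ?_)
      (not_le.2 hlg)
    · have h3 := h2 _ _ (hlt n hn)
      have h4 := h2 _ _ (hlt n' hn')
      have h : vt (i + (l.getD n (0, 0)).1) (l.getD n (0, 0)).2 =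
        vt (i + (l.getD n' (0, 0)).1) (l.getD n' (0, 0)).2 := h
      rw [h] at h3
      have h5 : l.getD n (0, 0) = l.getD n' (0, 0) :=
        Prod.ext (by have := h3.1.symm.trans h4.1; omega) (h3.2.symm.trans h4.2)
      rw [List.getD_eq_getElem _ _ hn, List.getD_eq_getElem _ _ hn'] at h5
      exact (hnd.getElem_inj_iff).1 h5
    · have hn' : (n + 1) % l.length < l.length := Nat.mod_lt _ (by omega)
      have h3 := hcyc n hn
      rw [wadj_shift] at h3
      exact (hadj _ _ _ _ (hlt n hn) (hlt _ hn')).1 h3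
  · have h3 (i : ℕ) : (s i).1 = ∑ v, if G.dist x v = i then 1 else 0 := by
      rw [← sum_layer h1 h2 (fun _ => 1)]
      simp [s]
    rw [Finset.sum_congr rfl fun i _ => h3 i, Finset.sum_comm]
    refine (Finset.sum_le_sum fun v _ => ?_).trans_eq (Finset.card_eq_sum_ones _).symm
    rw [Finset.sum_ite_eq]
    split_ifs <;> simp

end LayerWord

/-! ### From closed words to graphs of large diameter -/

namespace GirthGraph

variable {V : Type}

theorem le_dist_of_lipschitz {G : SimpleGraph V} (hG : G.Connected) {φ : V → ℕ}
    (hφ : ∀ z w, G.Adj z w → φ w ≤ φ z + 1) (x y : V) : φ y ≤ φ x + G.dist x y := by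
  obtain ⟨p, hp⟩ := hG.exists_walk_length_eq_dist x y
  rw [← hp]
  exact le_add_length_of_lipschitz (E := ∅) (fun z w h _ => hφ z w h) p (by simp)

end GirthGraph

namespace LayerWord

open SlidingWord GirthGraph

/-- The number of neighbours of the vertex `(i, x)` in layer `j`. -/
def nbrs (s : ℕ → ℕ × ℕ) (i x j : ℕ) : ℕ :=
  ∑ y ∈ Finset.range (s j).1, if WAdj s (i, x) (j, y) then 1 else 0

/-- The vertices in the layers `o, …, o + L` of a word. -/
abbrev Segment (s : ℕ → ℕ × ℕ) (o L : ℕ) : Type := Σ i : Fin (L + 1), Fin (s (o + i)).1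

/-- The position of a vertex of a segment. -/
def Segment.pos {s : ℕ → ℕ × ℕ} {o L : ℕ} (z : Segment s o L) : ℕ × ℕ := (o + z.1, z.2)

theorem Segment.pos_injective {s : ℕ → ℕ × ℕ} {o L : ℕ} :
    Function.Injective (Segment.pos : Segment s o L → ℕ × ℕ) := by
  rintro ⟨i, x⟩ ⟨j, y⟩ h
  simp only [Segment.pos, Prod.mk.injEq] at h
  obtain rfl : i = j := Fin.ext (by omega)
  obtain rfl : x = y := Fin.ext h.2
  rfl

/-- The graph on the layers `o, …, o + L` of a word. -/
def segmentGraph (s : ℕ → ℕ × ℕ) (o L : ℕ) : SimpleGraph (Segment s o L) where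
  Adj z w := WAdj s z.pos w.pos
  symm := ⟨fun _ _ h => h.symm⟩
  loopless := ⟨fun _ h => h.ne rfl⟩

theorem WAdj.layer_le {s : ℕ → ℕ × ℕ} {z w : ℕ × ℕ} (h : WAdj s z w) :
    w.1 ≤ z.1 + 1 ∧ z.1 ≤ w.1 + 1 := by
  rcases h with ⟨h, -⟩ | ⟨h, -⟩ | ⟨h, -⟩ <;> omega

theorem sum_three {h : ℕ → ℕ} {o L I : ℕ} (ho : 1 ≤ o) (hI : o ≤ I) (hI' : I ≤ o + L)
    (hz : ∀ J, h J ≠ 0 → J ≤ I + 1 ∧ I ≤ J + 1) :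
    ∑ j ∈ Finset.range (L + 1), h (o + j) + ((if I = o then h (o - 1) else 0) +
      (if I = o + L then h (o + L + 1) else 0)) = ∑ t ∈ Finset.range 3, h (I - 1 + t) := by
  have h1 : (if I = o then h (o - 1) else 0) = h (o - 1) := by
    split_ifs with hc
    · rfl
    · by_contra hne
      have := hz _ (Ne.symm hne)
      omega
  have h2 : (if I = o + L then h (o + L + 1) else 0) = h (o + L + 1) := by
    split_ifs with hc
    · rfl
    · by_contra hne
      have := hz _ (Ne.symm hne)
      omega
  have h3 : ∑ J ∈ Finset.range (L + 3), h (o - 1 + J) =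
      h (o - 1) + ∑ j ∈ Finset.range (L + 1), h (o + j) + h (o + L + 1) := by
    rw [Finset.sum_range_succ, Finset.sum_range_succ', add_zero,
      show o - 1 + (L + 2) = o + L + 1 by omega, add_comm (h (o - 1))]
    congr 2
    exact Finset.sum_congr rfl fun j _ => by rw [show o - 1 + (j + 1) = o + j by omega]
  have h4 : ∑ J ∈ Finset.range (L + 3), h (o - 1 + J) =
      ∑ t ∈ Finset.range 3, h (I - 1 + t) := by
    rw [show L + 3 = (I - o) + (3 + (o + L - I)) by omega, Finset.sum_range_add,
      Finset.sum_range_add, Finset.sum_eq_zero, zero_add,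
      Finset.sum_eq_zero (s := Finset.range (o + L - I)), add_zero]
    · exact Finset.sum_congr rfl fun t _ => by congr 1; omega
    · intro t _
      by_contra hne
      have := hz _ hne
      omega
    · intro t ht
      have := Finset.mem_range.1 ht
      by_contra hne
      have := hz _ hne
      omega
  rw [h1, h2, ← h4, h3]
  omega

section Segment

variable {k g : ℕ} {s : ℕ → ℕ × ℕ}

/-- A cycle with fewer than `g` vertices stays within distance `g` of the layer of its first vertex,
hence inside the window centred at that layer. -/
theorem girthGe_segment (hs : ∀ i, Window k g fun t => s (i + t)) (L : ℕ) :
    GirthGe (segmentGraph s (g + 1) L) g := by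
  refine girthGe_of_not_cyclic fun n hn hng q hq hadj => ?_
  set i₀ := ((q 0).1 : ℕ) with hi₀
  have hlayer : ∀ j < n, ((q j).1 : ℕ) ≤ i₀ + j ∧ i₀ ≤ (q j).1 + j := by
    intro j
    induction j with
    | zero => intro; simp [hi₀]
    | succ j ih =>
      intro hj
      have h1 := ih (by omega)
      have h2 := (hadj j (by omega)).layer_le
      rw [Nat.mod_eq_of_lt hj] at h2
      simp only [Segment.pos] at h2
      omega
  let r (j : ℕ) : ℕ × ℕ := (g + 1 + (q j).1 - (i₀ + 1), (q j).2)
  have hr : ∀ j < n, (i₀ + 1 + (r j).1, (r j).2) = (q j).pos := by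
    intro j hj
    have := hlayer j hj
    simp only [r, Segment.pos, Prod.mk.injEq, and_true]
    omega
  let l := (List.range n).map r
  have hlen : l.length = n := by simp [l]
  have hget : ∀ j < n, l.getD j (0, 0) = r j := by
    intro j hj
    rw [List.getD_eq_getElem _ _ (by rw [hlen]; exact hj)]
    simp [l]
  refine (hs (i₀ + 1)).no_short_cycle l (by omega) (by omega) (fun z hz => ?_) ?_ fun j hj => ?_
  · obtain ⟨j, hj, rfl⟩ := List.mem_map.1 hz
    have hj := List.mem_range.1 hj
    have h1 := hlayer j hj
    refine ⟨by simp only [r]; omega, ?_⟩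
    have h2 := congrArg Prod.fst (hr j hj)
    simp only at h2
    simp only [h2]
    exact (q j).2.2
  · refine List.Nodup.map_on (fun i hi j hj hij => ?_) List.nodup_range
    have hi := List.mem_range.1 hi
    have hj := List.mem_range.1 hj
    refine hq hi hj (Segment.pos_injective ?_)
    rw [← hr i hi, ← hr j hj, hij]
  · rw [hlen] at hj ⊢
    have hj' : (j + 1) % n < n := Nat.mod_lt _ (by omega)
    rw [wadj_shift, hget j hj, hget _ hj', hr j hj, hr _ hj']
    exact hadj j hj

theorem dg_segment (o L : ℕ) (z : Segment s o L) : dg (segmentGraph s o L) z =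
    ∑ j ∈ Finset.range (L + 1), nbrs s (o + z.1) z.2 (o + j) := by
  classical
  rw [dg, Fintype.sum_sigma, Finset.sum_range]
  refine Finset.sum_congr rfl fun j _ => ?_
  rw [nbrs, Finset.sum_range]
  refine Finset.sum_congr rfl fun y _ => ?_
  exact if_congr Iff.rfl rfl rfl

theorem sum_nbrs (hs : ∀ i, Window k g fun t => s (i + t)) (hg : 1 ≤ g) {I x : ℕ} (hI : g ≤ I)
    (hx : x < (s I).1) : ∑ t ∈ Finset.range 3, nbrs s I x (I - 1 + t) = k := by
  obtain ⟨i, rfl⟩ := Nat.exists_eq_add_of_le' hI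
  rw [← (hs i).regular x hx]
  refine Finset.sum_congr rfl fun t _ => ?_
  rw [nbrs, show i + g - 1 + t = i + (g - 1 + t) by omega]
  refine Finset.sum_congr rfl fun y _ => ?_
  simp only [wadj_shift]

theorem layer_le_of_nbrs_ne_zero {I x J : ℕ} (h : nbrs s I x J ≠ 0) : J ≤ I + 1 ∧ I ≤ J + 1 := by
  obtain ⟨y, -, hy⟩ := Finset.exists_ne_zero_of_sum_ne_zero h
  have : WAdj s (I, x) (J, y) := by
    by_contra hc
    simp [hc] at hy
  exact this.layer_le

/-- The number of missing edges at a vertex of a segment. -/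
def missing (s : ℕ → ℕ × ℕ) (o L : ℕ) (z : Segment s o L) : ℕ :=
  (if (z.1 : ℕ) = 0 then nbrs s o z.2 (o - 1) else 0) +
    (if (z.1 : ℕ) = L then nbrs s (o + L) z.2 (o + L + 1) else 0)

theorem dg_add_missing (hs : ∀ i, Window k g fun t => s (i + t)) (hg : 1 ≤ g) (L : ℕ)
    (z : Segment s (g + 1) L) :
    dg (segmentGraph s (g + 1) L) z + missing s (g + 1) L z = k := by
  have hz := Nat.lt_succ_iff.1 z.1.2
  rw [dg_segment, ← sum_nbrs hs hg (I := g + 1 + z.1) (x := z.2) (by omega) z.2.2,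
    ← sum_three (o := g + 1) (L := L) (by omega) (by omega) (by omega)
      fun J hJ => layer_le_of_nbrs_ne_zero hJ]
  congr 1
  unfold missing
  congr 1
  · by_cases h : (z.1 : ℕ) = 0 <;> simp [h]
  · by_cases h : (z.1 : ℕ) = L <;> simp [h]

theorem sum_level_missing (o L t : ℕ) :
    ∑ z : Segment s o L, (if (z.1 : ℕ) = t then missing s o L z else 0) =
      (if t = 0 then ∑ x ∈ Finset.range (s o).1, nbrs s o x (o - 1) else 0) +
      (if t = L then ∑ x ∈ Finset.range (s (o + L)).1, nbrs s (o + L) x (o + L + 1) else 0) := by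
  rw [Fintype.sum_sigma]
  have h (i : Fin (L + 1)) : ∑ x : Fin (s (o + i)).1,
      (if (i : ℕ) = t then missing s o L ⟨i, x⟩ else 0) =
      (if (i : ℕ) = 0 then (if t = 0 then ∑ x ∈ Finset.range (s o).1, nbrs s o x (o - 1) else 0)
        else 0) + (if (i : ℕ) = L then (if t = L then
          ∑ x ∈ Finset.range (s (o + L)).1, nbrs s (o + L) x (o + L + 1) else 0) else 0) := by
    have h0 : ∑ x : Fin (s (o + i)).1, missing s o L ⟨i, x⟩ =
        (if (i : ℕ) = 0 then ∑ x ∈ Finset.range (s o).1, nbrs s o x (o - 1) else 0) +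
        (if (i : ℕ) = L then ∑ x ∈ Finset.range (s (o + L)).1, nbrs s (o + L) x (o + L + 1)
          else 0) := by
      simp only [missing]
      rw [Finset.sum_add_distrib]
      congr 1
      · split_ifs with hi
        · rw [Finset.sum_range (n := (s o).1), hi, add_zero]
        · simp
      · split_ifs with hi
        · rw [Finset.sum_range (n := (s (o + L)).1), hi]
        · simp
    by_cases hit : (i : ℕ) = t
    · subst hit
      simp only [if_true, h0]
      congr 1 <;> (split_ifs <;> rfl)
    · have h1 : ¬ ((i : ℕ) = 0 ∧ t = 0) := by omega
      have h2 : ¬ ((i : ℕ) = L ∧ t = L) := by omega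
      simp only [if_neg hit, Finset.sum_const_zero, ← ite_and, if_neg h1, if_neg h2, add_zero]
  rw [Finset.sum_congr rfl fun i _ => h i, Finset.sum_add_distrib]
  congr 1
  · rw [Finset.sum_eq_single (0 : Fin (L + 1))]
    · simp
    · intro i _ hi
      exact if_neg fun h => hi (Fin.ext h)
    · simp
  · rw [Finset.sum_eq_single (Fin.last L)]
    · simp
    · intro i _ hi
      exact if_neg fun h => hi (Fin.ext h)
    · simp

theorem sum_nbrs_succ (J : ℕ) : ∑ x ∈ Finset.range (s J).1, nbrs s J x (J + 1) =
    ∑ x ∈ Finset.range (s J).1, ∑ y ∈ Finset.range (s (J + 1)).1,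
      if Outer (s J) x y then 1 else 0 := by
  refine Finset.sum_congr rfl fun x _ => Finset.sum_congr rfl fun y _ => ?_
  refine if_congr ⟨?_, fun h => .inr (.inl ⟨rfl, h⟩)⟩ rfl rfl
  rintro (⟨h, -⟩ | ⟨-, h⟩ | ⟨h, -⟩)
  · simp at h
  · exact h
  · have : J = J + 1 + 1 := h
    omega

theorem sum_nbrs_pred (J : ℕ) : ∑ x ∈ Finset.range (s (J + 1)).1, nbrs s (J + 1) x J =
    ∑ x ∈ Finset.range (s J).1, ∑ y ∈ Finset.range (s (J + 1)).1,
      if Outer (s J) x y then 1 else 0 := by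
  rw [Finset.sum_comm]
  refine Finset.sum_congr rfl fun x _ => Finset.sum_congr rfl fun y _ => ?_
  refine if_congr ⟨?_, fun h => .inr (.inr ⟨rfl, h⟩)⟩ rfl rfl
  rintro (⟨h, -⟩ | ⟨h, -⟩ | ⟨-, h⟩)
  · simp at h
  · have : J = J + 1 + 1 := h
    omega
  · exact h

theorem even_outer (hs : ∀ i, Window k g fun t => s (i + t)) (hk : Even k) {J : ℕ} (hJ : g ≤ J) :
    Even (∑ x ∈ Finset.range (s J).1, ∑ y ∈ Finset.range (s (J + 1)).1,
      if Outer (s J) x y then 1 else 0) := by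
  obtain ⟨i, rfl⟩ := Nat.exists_eq_add_of_le' hJ
  exact Nat.even_iff.2 ((hs i).even_cut (Nat.even_iff.1 hk))

/-- The missing half-edges at either end are the edges of a cut between consecutive layers. The
segment starts at layer `g + 1` so that layer `g`, below the lower cut, is still the centre of a
window. This is the parity that `exists_completion` needs. -/
theorem even_level_missing (hs : ∀ i, Window k g fun t => s (i + t)) (hk : Even k) (L t : ℕ) :
    Even (∑ z : Segment s (g + 1) L, if (z.1 : ℕ) = t then missing s (g + 1) L z else 0) := by
  rw [sum_level_missing, Nat.add_sub_cancel, sum_nbrs_succ, sum_nbrs_pred]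
  refine Even.add ?_ ?_
  · split_ifs
    · exact even_outer hs hk le_rfl
    · exact Even.zero
  · split_ifs
    · exact even_outer hs hk (by omega)
    · exact Even.zero

theorem sum_missing (o L : ℕ) : ∑ z : Segment s o L, missing s o L z =
    ∑ x ∈ Finset.range (s o).1, nbrs s o x (o - 1) +
      ∑ x ∈ Finset.range (s (o + L)).1, nbrs s (o + L) x (o + L + 1) := by
  have h (z : Segment s o L) : missing s o L z =
      ∑ t ∈ Finset.range (L + 1), if (z.1 : ℕ) = t then missing s o L z else 0 := by
    rw [Finset.sum_ite_eq, if_pos (Finset.mem_range.2 z.1.2)]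
  rw [Finset.sum_congr rfl fun z _ => h z, Finset.sum_comm,
    Finset.sum_congr rfl fun t _ => sum_level_missing o L t, Finset.sum_add_distrib]
  simp

theorem nbrs_le (hs : ∀ i, Window k g fun t => s (i + t)) (hg : 1 ≤ g) {I x J : ℕ} (hI : g ≤ I)
    (hx : x < (s I).1) : nbrs s I x J ≤ k := by
  by_cases h : nbrs s I x J = 0
  · omega
  · have h1 := layer_le_of_nbrs_ne_zero h
    have h2 := sum_nbrs hs hg hI hx
    simp only [Finset.sum_range_succ, Finset.sum_range_zero] at h2
    rcases (by omega : J = I - 1 + 0 ∨ J = I - 1 + 1 ∨ J = I - 1 + 2) with rfl | rfl | rfl <;> omega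

theorem sum_missing_le (hs : ∀ i, Window k g fun t => s (i + t)) (hg : 1 ≤ g) {A : ℕ}
    (hA : ∀ i, (s i).1 ≤ A) (L : ℕ) :
    ∑ z : Segment s (g + 1) L, missing s (g + 1) L z ≤ 2 * (A * k) := by
  rw [sum_missing, two_mul]
  refine add_le_add ?_ ?_
  all_goals
    refine (Finset.sum_le_card_nsmul _ _ k fun x hx =>
      nbrs_le hs hg (by omega) (Finset.mem_range.1 hx)).trans ?_
    rw [Finset.card_range, smul_eq_mul]
    exact Nat.mul_le_mul_right _ (hA _)

theorem card_segment (o L : ℕ) :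
    Fintype.card (Segment s o L) = ∑ i ∈ Finset.range (L + 1), (s (o + i)).1 := by
  rw [Fintype.card_sigma, Finset.sum_range]
  simp

/-- The backward neighbours lead down layer by layer; this puts a top and a bottom vertex into one
component, although the segment may be disconnected. -/
theorem exists_reachable_bottom (hs : ∀ i, Window k g fun t => s (i + t)) (hg : 1 ≤ g) (L : ℕ) :
    ∀ z : Segment s (g + 1) L, ∃ w : Segment s (g + 1) L, (w.1 : ℕ) = 0 ∧
      (segmentGraph s (g + 1) L).Reachable z w := by
  rintro ⟨⟨i, hi⟩, x⟩
  induction i with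
  | zero => exact ⟨_, rfl, .refl _⟩
  | succ i ih =>
    obtain ⟨y, hy, hyx⟩ := (hs (i + 2)).back x (by
      have := x.2
      simpa only [show i + 2 + g = g + 1 + (i + 1) by omega] using this)
    have he : i + 2 + (g - 1) = g + 1 + i := by omega
    simp only [he] at hy hyx
    obtain ⟨w, hw, hr⟩ := ih (by omega) ⟨y, hy⟩
    refine ⟨w, hw, SimpleGraph.Reachable.trans (SimpleGraph.Adj.reachable ?_) hr⟩
    exact .inr (.inr ⟨by simp only [Segment.pos]; omega, hyx⟩)

/-- Graphs of large diameter whose order grows at the rate given by a closed word. -/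
theorem exists_graph_of_closed (hk : 1 ≤ k) (hg : 1 ≤ g) {u : List (ℕ × ℕ)}
    (hu : Closed (Window k g) u) : ∃ C, ∀ L, ∃ (V : Type) (_ : Fintype V) (G : SimpleGraph V),
      G.Connected ∧ (∀ x, dg G x = k) ∧ GirthGe G g ∧ (∃ x y, L ≤ G.dist x y) ∧
      u.length * Fintype.card V ≤ weight Prod.fst u * L + C := by
  obtain ⟨W, _, H, a, b, hab, hH, hHg⟩ := RegularGraph.exists_regular k g hk hg
  set s := cyc u with hs_def
  have hs : ∀ i, Window k g fun t => s (i + t) := hu.2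
  have hulen : 0 < u.length := List.length_pos_of_ne_nil hu.1
  have hA : ∀ i, (s i).1 ≤ weight Prod.fst u := fun i =>
    List.single_le_sum (fun _ _ => Nat.zero_le _) _ (List.mem_map_of_mem (cyc_mem hu.1 i))
  set m := weight Prod.fst u with hm
  set X := 1 + (1 + k) * Fintype.card W with hX
  -- The first summand pays for the initial layers and for rounding up to whole periods, the second
  -- for the vertices added at the two ends.
  refine ⟨m * (g + 2 + u.length) + u.length * (2 * (m * k) * X), fun L => ?_⟩
  obtain ⟨V', _, G', lab', ι, hc, hcard⟩ := exists_completion hg hH hHg hab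
    (segmentGraph s (g + 1) L) (missing s (g + 1) L) (fun z => z.1) (girthGe_segment hs L)
    (fun x y h => by
      have := (WAdj.layer_le h).1
      simp only [Segment.pos] at this
      omega) (fun hke t => even_level_missing hs hke L t)
  let top : Segment s (g + 1) L := ⟨Fin.last L, ⟨0, by
    have := (hs (L + 1)).pos
    simpa only [show L + 1 + g = g + 1 + (Fin.last L : ℕ) by simp; omega] using this⟩⟩
  obtain ⟨bot, hbot, hreach⟩ := exists_reachable_bottom hs hg L top
  obtain ⟨V, i, G, κ, hκ, hκadj, hκr, hGc, hGd, hVcard⟩ := exists_component G' (ι bot)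
  have hreach' : G'.Reachable (ι bot) (ι top) :=
    (hreach.symm).map (⟨ι, fun {x y} h => hc.adj x y h⟩ : segmentGraph s (g + 1) L →g G')
  obtain ⟨x, hx⟩ := (hκr (ι bot)).2 (.refl _)
  obtain ⟨y, hy⟩ := (hκr (ι top)).2 hreach'
  refine ⟨V, i, G, hGc, fun z => ?_, hc.girthGe.comap κ hκ fun _ _ => (hκadj _ _).1,
    ⟨x, y, ?_⟩, ?_⟩
  · rw [hGd]
    by_cases hz : κ z ∈ Set.range ι
    · obtain ⟨z', hz'⟩ := hz
      rw [← hz', hc.degree, dg_add_missing hs hg]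
    · exact hc.degree_new _ hz
  -- The extended labelling is 0 at the bottom vertex, `L` at the top vertex, and Lipschitz, so the
  -- completion creates no shortcut.
  · have := le_dist_of_lipschitz hGc (φ := lab' ∘ κ)
      (fun z w h => hc.lipschitz _ _ ((hκadj _ _).1 h)) x y
    simp only [Function.comp_apply, hx, hy, hc.label, hbot, top, Fin.val_last] at this
    omega
  · have h1 := sum_missing_le hs hg hA L
    have h2 : u.length * Fintype.card (Segment s (g + 1) L) ≤ m * (L + g + 2 + u.length) := by
      rw [card_segment]
      set q := (L + g + 2) / u.length + 1 with hq
      have h3 : L + g + 2 ≤ u.length * q := by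
        have := Nat.lt_mul_div_succ (L + g + 2) hulen
        exact this.le
      have h4 : ∑ i ∈ Finset.range (L + 1), (s (g + 1 + i)).1 ≤ q * m := by
        rw [hm, ← sum_cyc_mul]
        calc ∑ i ∈ Finset.range (L + 1), (s (g + 1 + i)).1
            ≤ ∑ i ∈ Finset.range (g + 1 + (L + 1)), (s i).1 := by
              rw [Finset.sum_range_add _ (g + 1)]
              exact Nat.le_add_left _ _
          _ ≤ _ := Finset.sum_le_sum_of_subset (Finset.range_mono (by omega))
      have h5 : u.length * q ≤ L + g + 2 + u.length := by
        rw [hq, mul_add, mul_one]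
        have := Nat.mul_div_le (L + g + 2) u.length
        omega
      calc u.length * _ ≤ u.length * (q * m) := Nat.mul_le_mul_left _ h4
        _ = m * (u.length * q) := by ring
        _ ≤ _ := Nat.mul_le_mul_left _ h5
    have h6 : (∑ z, missing s (g + 1) L z) * X ≤ 2 * (m * k) * X := Nat.mul_le_mul_right _ h1
    calc u.length * Fintype.card V
        ≤ u.length * (Fintype.card (Segment s (g + 1) L) + 2 * (m * k) * X) :=
          Nat.mul_le_mul_left _ ((hVcard.trans hcard).trans (Nat.add_le_add_left h6 _))
      _ ≤ m * (L + g + 2 + u.length) + u.length * (2 * (m * k) * X) := by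
          rw [mul_add]
          exact Nat.add_le_add_right h2 _
      _ = _ := by ring

end Segment

end LayerWord

/-! ### Distances in a cap with one root, and tails of all large depths -/

namespace GirthGraph

variable {V W : Type}

section CapDist

variable {B : SimpleGraph V} {c : V} {Q : SimpleGraph W} {a b : W}

theorem cap_inl_inr_of_mem {x y : W} (h : s(x, y) = s(a, b)) :
    (cap B c c Q a b).Adj (.inl c) (.inr x) ∧ (cap B c c Q a b).Adj (.inl c) (.inr y) := by
  rcases Sym2.eq_iff.1 h with ⟨rfl, rfl⟩ | ⟨rfl, rfl⟩ <;> simp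

theorem cap_connected (hB : B.Connected) (hQ : Q.Connected) : (cap B c c Q a b).Connected := by
  have hl (x : V) : (cap B c c Q a b).Reachable (.inl x) (.inl c) :=
    (hB.preconnected x c).map (⟨Sum.inl, fun h => h⟩ : B →g cap B c c Q a b)
  have hr (x y : W) (p : Q.Walk x y) (hy : y = a) :
      (cap B c c Q a b).Reachable (.inr x) (.inl c) := by
    induction p with
    | nil =>
      subst hy
      exact SimpleGraph.Adj.reachable (by simp)
    | @cons x z y h p ih =>
      by_cases he : s(x, z) = s(a, b)
      · exact (cap_inl_inr_of_mem he).1.symm.reachable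
      · exact SimpleGraph.Adj.reachable (show (cap B c c Q a b).Adj (.inr x) (.inr z) from ⟨h, he⟩)
          |>.trans (ih hy)
  rw [SimpleGraph.connected_iff_exists_forall_reachable]
  refine ⟨.inl c, ?_⟩
  rintro (x | x)
  · exact (hl x).symm
  · obtain ⟨p⟩ := hQ.preconnected x a
    exact (hr x a p rfl).symm

theorem dist_le_succ_of_adj {G : SimpleGraph V} (hG : G.Connected) {x y z : V} (h : G.Adj y z) :
    G.dist x z ≤ G.dist x y + 1 := by
  have := hG.dist_triangle (u := x) (v := y) (w := z)
  rw [SimpleGraph.dist_eq_one_iff_adj.2 h] at this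
  exact this

theorem cap_dist_inl_inl (hB : B.Connected) (x y : V) (hQ : Q.Connected) :
    (cap B c c Q a b).dist (.inl x) (.inl y) = B.dist x y := by
  apply le_antisymm
  · obtain ⟨p, hp⟩ := hB.exists_walk_length_eq_dist x y
    rw [← hp, ← SimpleGraph.Walk.length_map (⟨Sum.inl, fun h => h⟩ : B →g cap B c c Q a b)]
    exact SimpleGraph.dist_le _
  · have := le_dist_of_lipschitz (cap_connected (c := c) (a := a) (b := b) hB hQ)
      (φ := Sum.elim (fun z => B.dist x z) fun _ => B.dist x c) (by
        rintro (z | z) (w | w) h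
        · exact dist_le_succ_of_adj hB h
        · rcases h with ⟨rfl, -⟩ | ⟨rfl, -⟩ <;> simp
        · rcases h with ⟨rfl, -⟩ | ⟨rfl, -⟩ <;> simp
        · simp) (.inl x) (.inl y)
    simpa using this

/-- Both half-edges start at `c`, which is therefore a cut vertex. -/
theorem cap_dist_inr_inl (hB : B.Connected) (hQ : Q.Connected) (w : W) (t : V) :
    (cap B c c Q a b).dist (.inr w) (.inl t) =
      (cap B c c Q a b).dist (.inr w) (.inl c) + B.dist c t := by
  have hΓ := cap_connected (c := c) (a := a) (b := b) hB hQ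
  apply le_antisymm
  · rw [← cap_dist_inl_inl (c := c) (a := a) (b := b) hB c t hQ]
    exact hΓ.dist_triangle
  · have := le_dist_of_lipschitz hΓ
      (φ := Sum.elim (fun z => (cap B c c Q a b).dist (.inr w) (.inl c) + B.dist c z)
        fun v => (cap B c c Q a b).dist (.inr w) (.inr v)) (by
        have key (v : W) (h : (cap B c c Q a b).Adj (.inl c) (.inr v)) := And.intro
          (dist_le_succ_of_adj hΓ (x := .inr w) h) (dist_le_succ_of_adj hΓ (x := .inr w) h.symm)
        rintro (z | z) (v | v) h
        · have := dist_le_succ_of_adj hB (x := c) h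
          simp only [Sum.elim_inl]
          omega
        · obtain rfl : z = c := by rcases h with ⟨rfl, -⟩ | ⟨rfl, -⟩ <;> rfl
          simpa using (key v h).1
        · obtain rfl : v = c := by rcases h with ⟨rfl, -⟩ | ⟨rfl, -⟩ <;> rfl
          simpa using (key z h.symm).2
        · exact dist_le_succ_of_adj hΓ h) (.inr w) (.inl t)
    simpa using this

/-- The distances from the attaching vertex do not depend on the attached graph. -/
theorem cap_dist_inr_root_le {V' : Type} {B' : SimpleGraph V'} {c' : V'} (hB : B.Connected)
    (hB' : B'.Connected) (hQ : Q.Connected) (w : W) :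
    (cap B c c Q a b).dist (.inl c) (.inr w) ≤ (cap B' c' c' Q a b).dist (.inl c') (.inr w) := by
  have hΓ := cap_connected (c := c) (a := a) (b := b) hB hQ
  have := le_dist_of_lipschitz (cap_connected (c := c') (a := a) (b := b) hB' hQ)
    (φ := Sum.elim (fun _ => 0) fun v => (cap B c c Q a b).dist (.inl c) (.inr v)) (by
      rintro (z | z) (v | v) h
      · simp
      · have : (cap B c c Q a b).Adj (.inl c) (.inr v) := by
          rcases h with ⟨-, rfl⟩ | ⟨-, rfl⟩ <;> simp
        simp [SimpleGraph.dist_eq_one_iff_adj.2 this]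
      · simp
      · exact dist_le_succ_of_adj hΓ h) (.inl c') (.inr w)
  simpa using this

/-- The edge `ab` is replaced by the detour through `c`, which costs one more step; even if a walk
uses `ab` repeatedly, one visit to `c` is enough. -/
theorem cap_dist_inr_inr_le (hB : B.Connected) (hQ : Q.Connected) (w w' : W) :
    (cap B c c Q a b).dist (.inr w) (.inr w') ≤ Q.dist w w' + 1 := by
  have hΓ := cap_connected (c := c) (a := a) (b := b) hB hQ
  set Γ := cap B c c Q a b with hΓdef
  have key (x y : W) (p : Q.Walk x y) : Γ.dist (.inr x) (.inr y) ≤ p.length ∨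
      Γ.dist (.inr x) (.inl c) + Γ.dist (.inl c) (.inr y) ≤ p.length + 1 := by
    induction p with
    | nil => simp
    | @cons x z y h p ih =>
      rw [SimpleGraph.Walk.length_cons]
      by_cases he : s(x, z) = s(a, b)
      · obtain ⟨h1, h2⟩ := cap_inl_inr_of_mem (B := B) (c := c) (Q := Q) he
        have h3 := SimpleGraph.dist_eq_one_iff_adj.2 h1.symm
        have h4 := SimpleGraph.dist_eq_one_iff_adj.2 h2
        have h5 := SimpleGraph.dist_eq_one_iff_adj.2 h2.symm
        have h6 := hΓ.dist_triangle (u := .inl c) (v := .inr z) (w := .inr y)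
        rw [← hΓdef] at h3 h4 h5
        rcases ih with ih | ih <;> right <;> omega
      · have h1 := SimpleGraph.dist_eq_one_iff_adj.2
          (show (cap B c c Q a b).Adj (.inr x) (.inr z) from ⟨h, he⟩)
        rw [← hΓdef] at h1
        have h2 := hΓ.dist_triangle (u := .inr x) (v := .inr z) (w := .inr y)
        have h3 := hΓ.dist_triangle (u := .inr x) (v := .inr z) (w := .inl c)
        rcases ih with ih | ih
        · left; omega
        · right; omega
  obtain ⟨p, hp⟩ := hQ.exists_walk_length_eq_dist w w'
  rw [← hp]
  have := hΓ.dist_triangle (u := .inr w) (v := .inl c) (w := .inr w')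
  rcases key _ _ p with h | h <;> omega

/-- The root `c` reaches `Q` only in `a` and `b`, both at distance at most 1 from `a` in `Q`. -/
theorem le_cap_dist_inl_inr (hB : B.Connected) (hQ : Q.Connected) (hab : Q.Adj a b) (w : W) :
    Q.dist a w ≤ (cap B c c Q a b).dist (.inl c) (.inr w) := by
  have := le_dist_of_lipschitz (cap_connected (c := c) (a := a) (b := b) hB hQ)
    (φ := Sum.elim (fun _ => 0) fun v => Q.dist a v) (by
      rintro (z | z) (v | v) h
      · simp
      · rcases h with ⟨-, rfl⟩ | ⟨-, rfl⟩ <;> simp [SimpleGraph.dist_eq_one_iff_adj.2 hab]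
      · simp
      · exact dist_le_succ_of_adj hQ h.1) (.inl c) (.inr w)
  simpa using this

end CapDist

/-- A graph with a root of degree `k - 2`, in which all other vertices have degree `k`, without
cycles shorter than `g` but with one of length `g`, and in which the greatest distance from the root
is `L`. -/
structure IsTail [Fintype V] (k g L : ℕ) (T : SimpleGraph V) (c : V) : Prop where
  connected : T.Connected
  root : dg T c = k - 2
  degree : ∀ x ≠ c, dg T x = k
  girthGe : GirthGe T g
  cycle : (SimpleGraph.cycleGraph g).IsContained T
  dist_le : ∀ x, T.dist c x ≤ L
  exists_dist : ∃ x, T.dist c x = L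

theorem exists_adj_of_dg_pos [Fintype V] {G : SimpleGraph V} {x : V} (h : 0 < dg G x) :
    ∃ y, G.Adj x y := by
  by_contra! hn
  simp [dg, hn] at h

theorem isContained_cap {n : ℕ} {B : SimpleGraph V} (h : (SimpleGraph.cycleGraph n).IsContained B) (s₁ s₂ : V)
    (Q : SimpleGraph W) (a b : W) : (SimpleGraph.cycleGraph n).IsContained (cap B s₁ s₂ Q a b) :=
  h.trans ⟨⟨⟨Sum.inl, fun h => h⟩, Sum.inl_injective⟩⟩

/-- The old root gains two edges and so reaches degree `k`, while the root `r` of `D` keeps degree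
`k - 2` and is adjacent to the old root. The depth grows by exactly one, as `D` itself contributes
at most `e + 1`. -/
theorem IsTail.succ [Fintype V] [Fintype W] {k g L e : ℕ} (hk : 3 ≤ k) (hg : 1 ≤ g)
    {T : SimpleGraph V} {c : V} (hT : IsTail k g L T c) {D : SimpleGraph W} {r : W}
    (hD : IsTail k g e D r) (he : e ≤ L) :
    ∃ b, IsTail k g (L + 1) (cap T c c D r b) (.inr r) := by
  classical
  obtain ⟨b, hb⟩ := exists_adj_of_dg_pos (G := D) (x := r) (by rw [hD.root]; omega)
  have h1 : (cap T c c D r b).dist (.inr r) (.inl c) = 1 :=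
    SimpleGraph.dist_eq_one_iff_adj.2 (by simp)
  refine ⟨b, cap_connected hT.connected hD.connected, ?_, ?_, hT.girthGe.cap hg hD.girthGe hb,
    isContained_cap hT.cycle _ _ _ _ _, ?_, ?_⟩
  · rw [dg_cap_inr hb, hD.root]
  · rintro (x | x) hx
    · rw [dg_cap_inl hb.ne]
      by_cases hxc : x = c
      · subst hxc
        rw [hT.root]
        simp only [if_true]
        omega
      · simp [hxc, hT.degree x hxc]
    · rw [dg_cap_inr hb, hD.degree]
      rintro rfl
      exact hx rfl
  · rintro (x | x)
    · rw [cap_dist_inr_inl hT.connected hD.connected, h1]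
      have := hT.dist_le x
      omega
    · have h2 := cap_dist_inr_inr_le (c := c) (a := r) (b := b) hT.connected hD.connected r x
      have := hD.dist_le x
      omega
  · obtain ⟨x, hx⟩ := hT.exists_dist
    refine ⟨.inl x, ?_⟩
    rw [cap_dist_inr_inl hT.connected hD.connected, h1, hx, add_comm]

theorem IsTail.exists_of_le [Fintype W] {k g e : ℕ} (hk : 3 ≤ k) (hg : 1 ≤ g)
    {D : SimpleGraph W} {r : W} (hD : IsTail k g e D r) (n : ℕ) :
    ∃ (V : Type) (_ : Fintype V) (T : SimpleGraph V) (c : V), IsTail k g (e + n) T c ∧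
      Fintype.card V = (n + 1) * Fintype.card W := by
  induction n with
  | zero => exact ⟨W, _, D, r, hD, by simp⟩
  | succ n ih =>
    obtain ⟨V, _, T, c, hT, hc⟩ := ih
    obtain ⟨b, hb⟩ := hT.succ hk hg hD (Nat.le_add_right e n)
    exact ⟨V ⊕ W, _, _, _, hb, by rw [Fintype.card_sum, hc]; ring⟩

/-- A cycle of length `g` with a pendant edge. -/
def lollipop (g : ℕ) (hg : 2 ≤ g) : SimpleGraph (Fin (g + 1)) where
  Adj i j := (i : ℕ) + 1 = j ∨ (j : ℕ) + 1 = i ∨ ((i : ℕ) = 0 ∧ (j : ℕ) = g - 1) ∨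
    ((j : ℕ) = 0 ∧ (i : ℕ) = g - 1)
  symm := ⟨fun i j h => by omega⟩
  loopless := ⟨fun i h => by omega⟩

/-- For an edge of the cycle the certificate is the distance the other way round; for the pendant
edge it is a jump at the end vertex. -/
theorem girthGe_lollipop {g : ℕ} (hg : 3 ≤ g) : GirthGe (lollipop g (by omega)) g := by
  have hne {i j i' j' : Fin (g + 1)} (h : s(i, j) ≠ s(i', j')) :
      ¬ ((i : ℕ) = i' ∧ (j : ℕ) = j') ∧ ¬ ((i : ℕ) = j' ∧ (j : ℕ) = i') := by
    simp only [Fin.val_inj]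
    rwa [Ne, Sym2.eq_iff, not_or] at h
  have key : ∀ x y, (lollipop g (by omega)).Adj x y → (x : ℕ) < y → ∃ φ : Fin (g + 1) → ℕ, φ x = 0 ∧
      g ≤ φ y + 1 ∧ ∀ z w, (lollipop g (by omega)).Adj z w → s(z, w) ≠ s(x, y) → φ w ≤ φ z + 1 := by
    intro x y hxy hlt
    by_cases h1 : (y : ℕ) = g
    · refine ⟨fun j => if (j : ℕ) = g then g else 0, ?_, ?_, fun z w hzw he => ?_⟩
      · exact if_neg (by omega)
      · simp only [h1, if_true]
        omega
      · have h2 := hne he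
        change _ ∨ _ at hxy hzw
        simp only
        split_ifs <;> omega
    · by_cases h2 : (x : ℕ) + 1 = y
      · refine ⟨fun j => if (j : ℕ) ≤ x then x - j else if (j : ℕ) = g then x + 1
          else x + 1 + (g - 1 - j), ?_, ?_, fun z w hzw he => ?_⟩
        · simp
        · simp only [h1, if_false]
          split_ifs <;> omega
        · have h2 := hne he
          change _ ∨ _ at hxy hzw
          simp only
          split_ifs <;> omega
      · refine ⟨fun j => min j (g - 1), ?_, ?_, fun z w hzw he => ?_⟩
        · change _ ∨ _ at hxy
          simp only
          omega
        · change _ ∨ _ at hxy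
          simp only
          omega
        · have h2 := hne he
          change _ ∨ _ at hxy hzw
          simp only
          omega
  intro x y hxy
  rcases lt_trichotomy (x : ℕ) y with h | h | h
  · exact key x y hxy h
  · exact absurd (Fin.ext h) hxy.ne
  · exact GirthGe.symm_function (key y x hxy.symm h)

theorem cycleGraph_isContained_lollipop {g : ℕ} (hg : 3 ≤ g) :
    (SimpleGraph.cycleGraph g).IsContained (lollipop g (by omega)) := by
  refine ⟨⟨⟨fun i => i.castSucc, fun {i j} h => ?_⟩, Fin.castSucc_injective g⟩⟩
  rw [SimpleGraph.cycleGraph_adj', Fin.val_sub, Fin.val_sub] at h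
  have hi := i.2
  have hj := j.2
  have key (i j : ℕ) (hi : i < g) (hj : j < g) (h : (g - j + i) % g = 1) :
      j + 1 = i ∨ (i = 0 ∧ j = g - 1) := by
    rcases lt_or_ge (g - j + i) g with h1 | h1
    · rw [Nat.mod_eq_of_lt h1] at h
      omega
    · rw [Nat.mod_eq_sub_mod h1, Nat.mod_eq_of_lt (by omega)] at h
      omega
  change (i : ℕ) + 1 = j ∨ (j : ℕ) + 1 = i ∨ ((i : ℕ) = 0 ∧ (j : ℕ) = g - 1) ∨
    ((j : ℕ) = 0 ∧ (i : ℕ) = g - 1)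
  rcases h with h | h
  · have := key i j hi hj h
    omega
  · have := key j i hj hi h
    omega

theorem dg_lollipop_le {g : ℕ} (hg : 3 ≤ g) (x : Fin (g + 1)) :
    dg (lollipop g (by omega)) x ≤ if (x : ℕ) = g then 1 else 3 := by
  classical
  rw [dg_eq_card]
  split_ifs with h
  · rw [Finset.card_le_one_iff_subset_singleton]
    refine ⟨⟨g - 1, by omega⟩, fun y hy => ?_⟩
    have hy : (lollipop g (by omega)).Adj x y := by simpa using hy
    change _ ∨ _ at hy
    simp only [Finset.mem_singleton, Fin.ext_iff]
    omega
  · let a : Fin (g + 1) := ⟨x + 1, by omega⟩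
    let b : Fin (g + 1) := ⟨if (x : ℕ) = 0 then g - 1 else x - 1, by split_ifs <;> omega⟩
    let c : Fin (g + 1) := 0
    refine (Finset.card_le_card (t := {a, b, c}) fun y hy => ?_).trans Finset.card_le_three
    have hy : (lollipop g (by omega)).Adj x y := by simpa using hy
    change _ ∨ _ at hy
    simp only [Finset.mem_insert, Finset.mem_singleton, Fin.ext_iff, a, b, c, Fin.val_zero]
    split_ifs <;> omega

/-- The lollipop is completed so that the end of the pendant edge becomes the root of degree `k - 2
≥ 1`. All its vertices lie on one level, and handshaking gives the required parity for even `k`. The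
component of the root contains the `g`-cycle. -/
theorem exists_isTail {k g : ℕ} (hk : 3 ≤ k) (hg : 3 ≤ g) :
    ∃ (V : Type) (_ : Fintype V) (e : ℕ) (T : SimpleGraph V) (c : V), IsTail k g e T c := by
  classical
  obtain ⟨W, _, H, a, b, hab, hH, hHg⟩ := RegularGraph.exists_regular k g (by omega) (by omega)
  set Z := lollipop g (by omega) with hZ
  let target (x : Fin (g + 1)) : ℕ := if x = Fin.last g then k - 2 else k
  have htar (x : Fin (g + 1)) : dg Z x ≤ target x := by
    have h1 : dg Z x ≤ _ := dg_lollipop_le hg x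
    have h2 : x = Fin.last g ↔ (x : ℕ) = g := by simp [Fin.ext_iff]
    simp only [target, h2]
    clear_value Z
    split_ifs at h1 ⊢ <;> omega
  obtain ⟨V', _, G', lab', ι, hc, -⟩ := exists_completion (by omega) hH hHg hab Z
    (fun x => target x - dg Z x) (fun _ => 0) (girthGe_lollipop hg) (by simp) (fun hke t => by
      by_cases ht : 0 = t
      · simp only [if_pos ht]
        have h1 : ∑ x, (target x - dg Z x) + ∑ x, dg Z x = ∑ x, target x := by
          rw [← Finset.sum_add_distrib]
          exact Finset.sum_congr rfl fun x _ => Nat.sub_add_cancel (htar x)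
        have h2 : Even (∑ x, target x) := Finset.even_sum _ fun x _ => by
          simp only [target]
          split_ifs
          · exact (Nat.even_sub (by omega)).2 (by simp [hke])
          · exact hke
        rw [← h1, Nat.even_add] at h2
        exact h2.2 (even_sum_dg Z)
      · simp [if_neg ht])
  obtain ⟨V, i, G, κ, hκ, hκadj, hκr, hGc, hGd, -⟩ := exists_component G' (ι (Fin.last g))
  obtain ⟨c, hcκ⟩ := (hκr _).2 (.refl (ι (Fin.last g)))
  have hZr : ∀ n (hn : n ≤ g), Z.Reachable ⟨g, by omega⟩ ⟨g - n, by omega⟩ := by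
    intro n
    induction n with
    | zero => intro _; exact .refl _
    | succ n ih =>
      intro hn
      refine (ih (by omega)).trans (SimpleGraph.Adj.reachable ?_)
      right; left
      simp only
      omega
  have hmem (x : Fin (g + 1)) : ι x ∈ Set.range κ := by
    rw [hκr]
    have h1 := hZr (g - x) (by omega)
    have h2 : (⟨g - (g - x), by omega⟩ : Fin (g + 1)) = x := Fin.ext (by simp only; omega)
    rw [h2] at h1
    exact h1.map (⟨ι, fun {x y} h => hc.adj x y h⟩ : Z →g G')
  choose ρ hρ using hmem
  have hdeg (x : Fin (g + 1)) : dg G (ρ x) = target x := by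
    rw [hGd, hρ, hc.degree]
    exact Nat.add_sub_of_le (htar x)
  have hρc : ρ (Fin.last g) = c := hκ (by rw [hρ, hcκ])
  have hρinj : Function.Injective ρ := fun x y h => hc.injective (by rw [← hρ, ← hρ, h])
  let E := Finset.univ.sup fun x => G.dist c x
  obtain ⟨x, -, hx⟩ := Finset.exists_mem_eq_sup (Finset.univ : Finset V) ⟨c, Finset.mem_univ c⟩
    fun x => G.dist c x
  refine ⟨V, i, E, G, c, hGc, ?_, fun x hx => ?_,
    hc.girthGe.comap κ hκ fun _ _ => (hκadj _ _).1,
    (cycleGraph_isContained_lollipop hg).trans ⟨⟨⟨ρ, fun {x y} h => ?_⟩, hρinj⟩⟩,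
    fun x => Finset.le_sup (f := fun x => G.dist c x) (Finset.mem_univ x), ⟨x, hx.symm⟩⟩
  · rw [← hρc, hdeg]
    simp [target]
  · by_cases hz : κ x ∈ Set.range ι
    · obtain ⟨y, hy⟩ := hz
      obtain rfl : ρ y = x := hκ (by rw [hρ, hy])
      rw [hdeg]
      refine if_neg ?_
      rintro rfl
      exact hx hρc
    · rw [hGd]
      exact hc.degree_new _ hz
  · rw [hκadj, hρ, hρ]
    exact hc.adj _ _ h

end GirthGraph

/-! ### Bounds for the orders of `(k;g,d)`-graphs -/

namespace GirthGraph

open SlidingWord LayerWord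

variable {V W : Type}

theorem dist_iso {G : SimpleGraph V} {G' : SimpleGraph W} (hG : G.Connected) (hG' : G'.Connected)
    (e : G ≃g G') (x y : V) : G'.dist (e x) (e y) = G.dist x y := by
  apply le_antisymm
  · obtain ⟨p, hp⟩ := hG.exists_walk_length_eq_dist x y
    rw [← hp, ← SimpleGraph.Walk.length_map e.toHom]
    exact SimpleGraph.dist_le _
  · obtain ⟨p, hp⟩ := hG'.exists_walk_length_eq_dist (e x) (e y)
    rw [← hp, ← SimpleGraph.Walk.length_map e.symm.toHom]
    have := SimpleGraph.dist_le (p.map e.symm.toHom)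
    simpa using this

theorem girth_eq_of_girthGe {G : SimpleGraph V} {g : ℕ} (hg : 3 ≤ g) (hG : GirthGe G g)
    (hc : (SimpleGraph.cycleGraph g).IsContained G) : G.girth = g := by
  obtain ⟨v, p, hp, hlen⟩ := (SimpleGraph.cycleGraph_isContained_iff hg).1 hc
  apply le_antisymm
  · exact hlen ▸ SimpleGraph.girth_le_length hp
  · obtain ⟨w, q, hq, hlen'⟩ := SimpleGraph.exists_girth_eq_length.2 fun h => h p hp
    rw [hlen']
    exact hG.le_length q hq

theorem diam_eq_of_dist [Finite V] {G : SimpleGraph V} (hG : G.Connected) {d : ℕ}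
    (hle : ∀ x y, G.dist x y ≤ d) (hd : ∃ x y, G.dist x y = d) : G.diam = d := by
  have := hG.nonempty
  obtain ⟨x, y, hxy⟩ := hd
  obtain ⟨x', y', h⟩ := G.exists_dist_eq_diam
  refine le_antisymm (h ▸ hle x' y') (hxy ▸ SimpleGraph.dist_le_diam ?_)
  exact SimpleGraph.connected_iff_ediam_ne_top.1 hG

theorem degree_eq_dg [Fintype V] (G : SimpleGraph V) [G.LocallyFinite] (x : V) :
    G.degree x = dg G x := by
  classical
  rw [dg_eq_card, ← SimpleGraph.card_neighborFinset_eq_degree]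
  congr 1
  ext y
  simp

theorem card_mem_girthDiamOrders [Fintype V] {G : SimpleGraph V} {k g d : ℕ} (hg : 3 ≤ g)
    (hG : G.Connected) (hk : ∀ x, dg G x = k) (hgirth : GirthGe G g)
    (hc : (SimpleGraph.cycleGraph g).IsContained G)
    (hle : ∀ x y, G.dist x y ≤ d) (hd : ∃ x y, G.dist x y = d) :
    Fintype.card V ∈ girthDiamOrders k g d := by
  let e := G.overFinIso rfl
  have hG' : (G.overFin rfl).Connected := e.connected_iff.1 hG
  let i : (G.overFin rfl).LocallyFinite := fun _ => Fintype.ofFinite _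
  refine ⟨G.overFin rfl, i, hG', fun x => ?_, ?_, ?_⟩
  · obtain ⟨x, rfl⟩ := e.surjective x
    rw [degree_eq_dg, ← hk x]
    exact (dg_congr e e.injective x (fun y => e.map_rel_iff.symm) fun z _ => e.surjective z).symm
  · rw [← e.girth_eq]
    exact girth_eq_of_girthGe hg hgirth hc
  · refine diam_eq_of_dist hG' (fun x y => ?_) ?_
    · obtain ⟨x, rfl⟩ := e.surjective x
      obtain ⟨y, rfl⟩ := e.surjective y
      rw [dist_iso hG hG']
      exact hle x y
    · obtain ⟨x, y, h⟩ := hd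
      exact ⟨e x, e y, by rw [dist_iso hG hG', h]⟩

theorem girthGe_of_girth_eq {G : SimpleGraph V} {g : ℕ} (h : G.girth = g) : GirthGe G g := by
  refine girthGe_of_not_cyclic fun n hn hng q hq hadj => ?_
  have hc : (SimpleGraph.cycleGraph n).IsContained G := by
    refine ⟨⟨⟨fun i => q i, fun {i j} h => ?_⟩, fun i j hij => Fin.ext (hq i.2 j.2 hij)⟩⟩
    rw [SimpleGraph.cycleGraph_adj', Fin.val_sub, Fin.val_sub] at h
    have key (i j : ℕ) (hi : i < n) (hj : j < n) (h : (n - j + i) % n = 1) :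
        (j + 1) % n = i := by
      rcases lt_or_ge (n - j + i) n with h1 | h1
      · rw [Nat.mod_eq_of_lt h1] at h
        rw [show j + 1 = n by omega, Nat.mod_self]
        omega
      · rw [Nat.mod_eq_sub_mod h1, Nat.mod_eq_of_lt (by omega)] at h
        rw [Nat.mod_eq_of_lt] <;> omega
    rcases h with h | h
    · have := hadj j j.2
      rw [key i j i.2 j.2 h] at this
      exact this.symm
    · have := hadj i i.2
      rwa [key j i j.2 i.2 h] at this
  obtain ⟨v, p, hp, hlen⟩ := (SimpleGraph.cycleGraph_isContained_iff hn).1 hc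
  have := SimpleGraph.girth_le_length hp
  omega

/-- The linear lower bound for the sums of the layer sizes of words carries over to orders. -/
theorem mul_le_of_mem_girthDiamOrders {k g d n m p C : ℕ} (hg : 1 ≤ g)
    (hlin : ∀ d s, Legal (Window k g) (2 * g) s d →
      m * d ≤ p * ∑ i ∈ Finset.range d, (s i).1 + C)
    (hn : n ∈ girthDiamOrders k g d) : m * d ≤ p * n + C := by
  obtain ⟨G, _, hG⟩ := hn
  have hdeg (x : Fin n) : dg G x = k := by rw [← degree_eq_dg, hG.regular x]
  have := hG.connected.nonempty
  obtain ⟨x, z, hd⟩ := G.exists_dist_eq_diam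
  obtain ⟨s, h1, h2⟩ := exists_legal_word hg hG.connected (girthGe_of_girth_eq hG.girth_eq) x
    (fun y _ => hdeg y) (fun h => (hdeg x).symm ▸ h) z
  rw [hd, hG.diam_eq] at h1 h2
  rw [Fintype.card_fin] at h2
  have h3 := hlin _ s h1
  have h4 := Nat.mul_le_mul_left p h2
  have h5 : m * d ≤ m * (d + 1) := Nat.mul_le_mul_left _ (Nat.le_succ _)
  omega

/-- Chains of copies of one tail give arbitrarily long legal words of bounded mean weight, with the
root as the exceptional vertex of the breadth-first search. -/
theorem exists_closed_window {k g : ℕ} (hk : 3 ≤ k) (hg : 3 ≤ g) :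
    ∃ u, Closed (Window k g) u := by
  obtain ⟨W, _, e, D, r, hD⟩ := exists_isTail hk hg
  refine exists_closed (w := 2 * g) (wt := Prod.fst) (Window.congr (by omega)) (exists_letters k g)
    (Fintype.card W) fun d₀ => ?_
  obtain ⟨V, _, T, c, hT, hcard⟩ := hD.exists_of_le hk (by omega) d₀
  obtain ⟨z, hz⟩ := hT.exists_dist
  obtain ⟨s, h1, h2⟩ := exists_legal_word (by omega) hT.connected hT.girthGe c hT.degree
    (fun h => by rw [hT.root]; exact (Nat.even_sub (by omega)).2 (by simp [h])) z
  refine ⟨_, s, ?_, h1, h2.trans ?_⟩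
  · omega
  · rw [hz, hcard, mul_comm]
    exact Nat.mul_le_mul_left _ (by omega)

theorem IsTail.cap_regular [Fintype V] [Fintype W] {k g L : ℕ} (hk : 3 ≤ k) {T : SimpleGraph V}
    {c : V} (hT : IsTail k g L T c) {G : SimpleGraph W} (hG : ∀ x, dg G x = k) {a b : W}
    (hab : G.Adj a b) (x : V ⊕ W) : dg (cap T c c G a b) x = k := by
  classical
  rcases x with x | x
  · rw [dg_cap_inl hab.ne]
    by_cases hxc : x = c
    · subst hxc
      rw [hT.root]
      simp only [if_true]
      omega
    · simp [hxc, hT.degree x hxc]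
  · rw [dg_cap_inr hab, hG]

/-- Attaching a tail to an end of a diameter. -/
theorem IsTail.card_add_mem_girthDiamOrders [Fintype V] [Fintype W] {k g L E : ℕ} (hk : 3 ≤ k)
    (hg : 3 ≤ g) {T : SimpleGraph V} {c : V} (hT : IsTail k g L T c) {G : SimpleGraph W}
    (hG : G.Connected) (hGk : ∀ x, dg G x = k) (hGg : GirthGe G g) {a b x : W} (hab : G.Adj a b)
    (hx : ∀ y z, G.dist y z ≤ G.dist a x) (hL : 1 ≤ L) (hL' : L ≤ G.dist a x)
    (hE : ∀ w, (cap T c c G a b).dist (.inl c) (.inr w) ≤ E)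
    (hE' : ∃ w, (cap T c c G a b).dist (.inl c) (.inr w) = E) :
    Fintype.card V + Fintype.card W ∈ girthDiamOrders k g (E + L) := by
  rw [← Fintype.card_sum]
  have hΓ := cap_connected (c := c) (a := a) (b := b) hT.connected hG
  have h1 (w : W) (t : V) := cap_dist_inr_inl (c := c) (a := a) (b := b) hT.connected hG w t
  have h2 := (le_cap_dist_inl_inr (c := c) hT.connected hG hab x).trans (hE x)
  refine card_mem_girthDiamOrders hg hΓ (hT.cap_regular hk hGk hab)
    (hT.girthGe.cap (by omega) hGg hab) (isContained_cap hT.cycle _ _ _ _ _) ?_ ?_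
  -- Two vertices of the tail are at distance at most `2L`, which is where `L ≤ G.dist a x` enters;
  -- two vertices of `G` may get one step farther apart, which `1 ≤ L` absorbs.
  · rintro (y | y) (z | z)
    · rw [cap_dist_inl_inl hT.connected _ _ hG]
      have h3 := hT.connected.dist_triangle (u := y) (v := c) (w := z)
      have h4 := hT.dist_le y
      have h5 := hT.dist_le z
      rw [SimpleGraph.dist_comm] at h4
      omega
    · rw [SimpleGraph.dist_comm, h1, SimpleGraph.dist_comm]
      exact add_le_add (hE z) (hT.dist_le y)
    · rw [h1, SimpleGraph.dist_comm]
      exact add_le_add (hE y) (hT.dist_le z)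
    · have h3 := cap_dist_inr_inr_le (c := c) (a := a) (b := b) hT.connected hG y z
      have h4 := hx y z
      omega
  · obtain ⟨w, hw⟩ := hE'
    obtain ⟨t, ht⟩ := hT.exists_dist
    exact ⟨.inr w, .inl t, by rw [h1, SimpleGraph.dist_comm, hw, ht]⟩

/-- The graph built from `u` has diameter at least `d - K`, and as its order is small, the lower
bound `hlin` keeps the diameter below `d - K` plus a constant. A tail of bounded depth at an end of
a diameter then raises it to exactly `d`. -/
theorem exists_mem_girthDiamOrders_le {k g C : ℕ} (hk : 3 ≤ k) (hg : 3 ≤ g) {u : List (ℕ × ℕ)}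
    (hu : Closed (Window k g) u)
    (hlin : ∀ d s, Legal (Window k g) (2 * g) s d →
      weight Prod.fst u * d ≤ u.length * ∑ i ∈ Finset.range d, (s i).1 + C) :
    ∃ C' d₀, ∀ d ≥ d₀, ∃ n ∈ girthDiamOrders k g d,
      u.length * n ≤ weight Prod.fst u * d + C' := by
  classical
  have hm : 1 ≤ weight Prod.fst u := by
    have h1 := (hu.2 0).pos
    rw [zero_add] at h1
    exact h1.trans_le (List.single_le_sum (fun _ _ => Nat.zero_le _) _
      (List.mem_map_of_mem (cyc_mem hu.1 g)))
  set m := weight Prod.fst u with hm_def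
  obtain ⟨W, _, e, D, r, hD⟩ := exists_isTail hk hg
  obtain ⟨C₁, hC₁⟩ := exists_graph_of_closed (by omega) (by omega) hu
  -- The diameter exceeds `d - K` by at most `C₁ + C`, and `E` exceeds the diameter by at most 2; so
  -- depth at least `e + 1` remains for the tail.
  set K := C₁ + C + 2 + e + 1 with hK
  refine ⟨u.length * ((K + 1) * Fintype.card W) + C₁, 2 * K, fun d hd => ?_⟩
  obtain ⟨V, _, G, hG, hGk, hGg, ⟨x₀, y₀, hxy₀⟩, hcard⟩ := hC₁ (d - K)
  rw [← hm_def] at hcard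
  obtain ⟨⟨a, x⟩, -, hax⟩ := Finset.exists_max_image (Finset.univ : Finset (V × V))
    (fun z => G.dist z.1 z.2) ⟨(x₀, y₀), Finset.mem_univ _⟩
  replace hax (y z : V) : G.dist y z ≤ G.dist a x := hax (y, z) (Finset.mem_univ _)
  obtain ⟨b, hab⟩ := exists_adj_of_dg_pos (G := G) (x := a) (by rw [hGk]; omega)
  have hlow := hxy₀.trans (hax x₀ y₀)
  have hup : G.dist a x ≤ d - K + (C₁ + C) := by
    obtain ⟨s, h1, h2⟩ := exists_legal_word (by omega) hG hGg a
      (fun y _ => hGk y) (fun h => (hGk a).symm ▸ h) x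
    have h3 := hlin _ s h1
    have h4 := Nat.mul_le_mul_left u.length h2
    have h5 : m * G.dist a x ≤ m * (d - K + (C₁ + C)) := by
      have h6 : m * G.dist a x ≤ m * (G.dist a x + 1) := Nat.mul_le_mul_left _ (Nat.le_succ _)
      have h7 : C₁ + C ≤ m * (C₁ + C) := Nat.le_mul_of_pos_left _ hm
      rw [mul_add]
      omega
    exact Nat.le_of_mul_le_mul_left h5 hm
  obtain ⟨w, -, hw⟩ := Finset.exists_mem_eq_sup (Finset.univ : Finset V) ⟨a, Finset.mem_univ a⟩
    fun w => (cap D r r G a b).dist (.inl r) (.inr w)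
  set E := Finset.univ.sup fun w => (cap D r r G a b).dist (.inl r) (.inr w) with hE_def
  have hE (w : V) : (cap D r r G a b).dist (.inl r) (.inr w) ≤ E :=
    Finset.le_sup (f := fun w => (cap D r r G a b).dist (.inl r) (.inr w)) (Finset.mem_univ w)
  have hE1 : G.dist a x ≤ E := (le_cap_dist_inl_inr hD.connected hG hab x).trans (hE x)
  have hE2 : E ≤ G.dist a x + 2 := by
    have h1 := (cap_connected (c := r) (a := a) (b := b) hD.connected hG).dist_triangle
      (u := .inl r) (v := .inr a) (w := .inr w)
    have h2 : (cap D r r G a b).dist (.inl r) (.inr a) = 1 :=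
      SimpleGraph.dist_eq_one_iff_adj.2 (by simp)
    have h3 := cap_dist_inr_inr_le (c := r) (a := a) (b := b) hD.connected hG a w
    have h4 := hax a w
    omega
  clear_value E
  obtain ⟨V', _, T, c, hT, hT'⟩ := hD.exists_of_le hk (by omega) (d - E - e)
  -- The depth of the tail `T` depends on `E`, so `E` was measured with `D` attached; it is the same
  -- for every attached graph.
  have heq (w : V) : (cap T c c G a b).dist (.inl c) (.inr w) =
      (cap D r r G a b).dist (.inl r) (.inr w) :=
    le_antisymm (cap_dist_inr_root_le hT.connected hD.connected hG w)
      (cap_dist_inr_root_le hD.connected hT.connected hG w)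
  have hmem := hT.card_add_mem_girthDiamOrders (E := E) hk hg hG hGk hGg hab hax
    (by omega) (by omega) (fun w => by rw [heq]; exact hE w) ⟨w, by rw [heq, hw]⟩
  rw [show E + (e + (d - E - e)) = d by omega] at hmem
  refine ⟨_, hmem, ?_⟩
  rw [hT', mul_add]
  have h1 : (d - E - e + 1) * Fintype.card W ≤ (K + 1) * Fintype.card W :=
    Nat.mul_le_mul_right _ (by omega)
  have h2 := Nat.mul_le_mul_left u.length h1
  have h3 : m * (d - K) ≤ m * d := Nat.mul_le_mul_left _ (by omega)
  omega

end GirthGraph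

/-! ### Primitive recursion with bounded quantifiers and sums -/

/-- All lists of length at most `n` with entries from `l`. -/
def listsUpTo {α : Type} (l : List α) : ℕ → List (List α)
  | 0 => [[]]
  | n + 1 => [] :: (listsUpTo l n).flatMap fun t => l.map fun x => x :: t

theorem mem_listsUpTo {α : Type} {l : List α} {n : ℕ} {t : List α} :
    t ∈ listsUpTo l n ↔ t.length ≤ n ∧ ∀ x ∈ t, x ∈ l := by
  induction n generalizing t with
  | zero =>
    rw [listsUpTo, List.mem_singleton, Nat.le_zero, List.length_eq_zero_iff]
    exact ⟨fun h => ⟨h, by simp [h]⟩, fun h => h.1⟩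
  | succ n ih =>
    cases t with
    | nil => simp [listsUpTo]
    | cons x t => simp [listsUpTo, ih]; tauto

section Bounded

variable {α β : Type} [Primcodable α] [Primcodable β]

theorem PrimrecPred.imp {p q : α → Prop} (hp : PrimrecPred p) (hq : PrimrecPred q) :
    PrimrecPred fun a => p a → q a :=
  (hp.not.or hq).of_eq fun _ => imp_iff_not_or.symm

theorem PrimrecRel.forall_mem {f : α → List β} {p : α → β → Prop} (hp : PrimrecRel p)
    (hf : Primrec f) : PrimrecPred fun a => ∀ b ∈ f a, p a b :=
  PrimrecRel.comp (PrimrecRel.forall_mem_list hp.swap) hf .id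

theorem PrimrecRel.forall_below {n : α → ℕ} {p : α → ℕ → Prop} (hp : PrimrecRel p)
    (hn : Primrec n) : PrimrecPred fun a => ∀ i < n a, p a i :=
  (hp.forall_mem (Primrec.list_range.comp hn)).of_eq fun a => by simp

theorem PrimrecRel.exists_below {n : α → ℕ} {p : α → ℕ → Prop} (hp : PrimrecRel p)
    (hn : Primrec n) : PrimrecPred fun a => ∃ i < n a, p a i :=
  (PrimrecRel.comp (PrimrecRel.exists_mem_list hp.swap) (Primrec.list_range.comp hn) .id).of_eq
    fun a => by simp [Function.swap]

theorem Primrec.sum_range {n : α → ℕ} {f : α → ℕ → ℕ} (hn : Primrec n) (hf : Primrec₂ f) :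
    Primrec fun a => ∑ i ∈ Finset.range (n a), f a i :=
  (Primrec.nat_rec' hn (.const 0) (h := fun a p => p.2 + f a p.1)
    (Primrec.nat_add.comp (Primrec.snd.comp .snd)
      (hf.comp .fst (Primrec.fst.comp .snd))).to₂).of_eq fun a => by
    induction n a with
    | zero => rfl
    | succ n ih => rw [Finset.sum_range_succ, ← ih]

theorem Primrec.nat_pow : Primrec₂ ((· ^ ·) : ℕ → ℕ → ℕ) := Primrec₂.unpaired'.1 Nat.Primrec.pow

theorem Primrec.listsUpTo : Primrec₂ (listsUpTo : List α → ℕ → List (List α)) :=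
  (Primrec.nat_rec (f := fun _ : List α => [[]])
    (g := fun l p => [] :: p.2.flatMap fun t => l.map fun x => x :: t) (.const _)
    (Primrec.list_cons.comp (.const [])
      (Primrec.list_flatMap (Primrec.snd.comp .snd)
        (Primrec.list_map (Primrec.fst.comp .fst)
          (Primrec.list_cons.comp .snd (Primrec.snd.comp .fst)).to₂).to₂)).to₂).of_eq fun l n => by
    induction n with
    | zero => rfl
    | succ n ih => rw [_root_.listsUpTo, ← ih]

end Bounded

/-! ### Optimality is decidable, and optimal words are found by search -/

namespace LayerWord

open SlidingWord Primrec

section Primrec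

variable {α : Type} [Primcodable α]

theorem primrecPred_hasBit {e j : α → ℕ} (he : Primrec e) (hj : Primrec j) :
    PrimrecPred fun a => HasBit (e a) (j a) :=
  Primrec.eq.comp (nat_mod.comp (nat_div.comp he (nat_pow.comp (.const 2) hj)) (.const 2)) (.const 1)

theorem primrecPred_inner {σ : α → ℕ × ℕ} {x y : α → ℕ} (hσ : Primrec σ) (hx : Primrec x)
    (hy : Primrec y) : PrimrecPred fun a => Inner (σ a) (x a) (y a) :=
  primrecPred_hasBit (snd.comp hσ) (nat_double.comp (Primrec₂.natPair.comp hx hy))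

theorem primrecPred_outer {σ : α → ℕ × ℕ} {x y : α → ℕ} (hσ : Primrec σ) (hx : Primrec x)
    (hy : Primrec y) : PrimrecPred fun a => Outer (σ a) (x a) (y a) :=
  primrecPred_hasBit (snd.comp hσ) (nat_double_succ.comp (Primrec₂.natPair.comp hx hy))

theorem primrecPred_wadj {v : α → ℕ → ℕ × ℕ} {z w : α → ℕ × ℕ} (hv : Primrec₂ v) (hz : Primrec z)
    (hw : Primrec w) : PrimrecPred fun a => WAdj (v a) (z a) (w a) := by
  have hz1 := fst.comp hz
  have hz2 := snd.comp hz
  have hw1 := fst.comp hw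
  have hw2 := snd.comp hw
  have hvz := hv.comp .id hz1
  have hvw := hv.comp .id hw1
  exact ((Primrec.eq.comp hz1 hw1).and ((Primrec.eq.comp hz2 hw2).not.and
    ((primrecPred_inner hvz hz2 hw2).or (primrecPred_inner hvz hw2 hz2)))).or
    (((Primrec.eq.comp hw1 (succ.comp hz1)).and (primrecPred_outer hvz hz2 hw2)).or
      ((Primrec.eq.comp hz1 (succ.comp hw1)).and (primrecPred_outer hvw hw2 hz2)))

theorem primrec_digits : Primrec digits :=
  nat_add.comp (nat_double.comp (Primrec₂.natPair.comp .id .id)) (.const 2)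

theorem nodup_iff_getD {l : List (ℕ × ℕ)} :
    l.Nodup ↔ ∀ i < l.length, ∀ j < i, ¬ l.getD i (0, 0) = l.getD j (0, 0) := by
  rw [List.nodup_iff_injective_get]
  constructor
  · intro h i hi j hj he
    rw [List.getD_eq_getElem _ _ hi, List.getD_eq_getElem _ _ (hj.trans hi)] at he
    have := congrArg Fin.val (@h ⟨i, hi⟩ ⟨j, hj.trans hi⟩ he)
    simp only at this
    omega
  · intro h i j hij
    have key (i j : Fin l.length) (hij : l.get i = l.get j) : ¬ (j : ℕ) < i := fun hlt =>
      h i i.2 j hlt (by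
        rw [List.getD_eq_getElem _ _ i.2, List.getD_eq_getElem _ _ j.2]
        exact hij)
    have h1 := key i j hij
    have h2 := key j i hij.symm
    exact Fin.ext (by omega)

/-- The vertices of a window. -/
def windowVertices (g : ℕ) (v : ℕ → ℕ × ℕ) : List (ℕ × ℕ) :=
  (List.range (2 * g + 1)).flatMap fun i => (List.range (v i).1).map fun x => (i, x)

theorem mem_windowVertices {g : ℕ} {v : ℕ → ℕ × ℕ} {z : ℕ × ℕ} :
    z ∈ windowVertices g v ↔ z.1 ≤ 2 * g ∧ z.2 < (v z.1).1 := by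
  obtain ⟨i, x⟩ := z
  simp [windowVertices]

/-- This makes the quantifier over possible cycles bounded, as primitive recursion demands. -/
theorem no_short_cycle_iff {g : ℕ} {v : ℕ → ℕ × ℕ} : (∀ l ∈ listsUpTo (windowVertices g v) g,
      3 ≤ l.length → l.length < g → l.Nodup →
      ¬ ∀ i < l.length, WAdj v (l.getD i (0, 0)) (l.getD ((i + 1) % l.length) (0, 0))) ↔
    ∀ l : List (ℕ × ℕ), 3 ≤ l.length → l.length < g →
    (∀ z ∈ l, z.1 ≤ 2 * g ∧ z.2 < (v z.1).1) → l.Nodup →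
    ¬ ∀ i < l.length, WAdj v (l.getD i (0, 0)) (l.getD ((i + 1) % l.length) (0, 0)) := by
  simp only [mem_listsUpTo, mem_windowVertices]
  exact ⟨fun h l h1 h2 h3 => h l ⟨h2.le, h3⟩ h1 h2, fun h l h1 h2 h3 => h l h2 h3 h1.2⟩

theorem window_iff {k g : ℕ} {v : ℕ → ℕ × ℕ} : Window k g v ↔
    (∀ t < 2 * g, (v t).2 < 2 ^ digits (max (v t).1 (v (t + 1)).1)) ∧ 0 < (v g).1 ∧
    (∀ x < (v g).1, ∑ t ∈ Finset.range 3, ∑ y ∈ Finset.range (v (g - 1 + t)).1,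
      (if WAdj v (g, x) (g - 1 + t, y) then 1 else 0) = k) ∧
    (∀ x < (v g).1, ∃ y < (v (g - 1)).1, Outer (v (g - 1)) y x) ∧
    (k % 2 = 0 → (∑ x ∈ Finset.range (v g).1, ∑ y ∈ Finset.range (v (g + 1)).1,
      (if Outer (v g) x y then 1 else 0)) % 2 = 0) ∧
    ∀ l ∈ listsUpTo (windowVertices g v) g, 3 ≤ l.length → l.length < g → l.Nodup →
      ¬ ∀ i < l.length, WAdj v (l.getD i (0, 0)) (l.getD ((i + 1) % l.length) (0, 0)) := by
  rw [no_short_cycle_iff]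
  exact ⟨fun ⟨h1, h2, h3, h4, h5, h6⟩ => ⟨h1, h2, h3, h4, h5, h6⟩,
    fun ⟨h1, h2, h3, h4, h5, h6⟩ => ⟨h1, h2, h3, h4, h5, h6⟩⟩

theorem primrecPred_window {k g : α → ℕ} {v : α → ℕ → ℕ × ℕ} (hk : Primrec k) (hg : Primrec g)
    (hv : Primrec₂ v) : PrimrecPred fun a => Window (k a) (g a) (v a) := by
  have hv1 {β : Type} [Primcodable β] {f : β → α} {i : β → ℕ} (hf : Primrec f) (hi : Primrec i) :
      Primrec fun b => (v (f b) (i b)).1 := fst.comp (hv.comp hf hi)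
  have hvf {β : Type} [Primcodable β] {f : β → α} (hf : Primrec f) : Primrec₂ fun b => v (f b) :=
    (hv.comp (hf.comp .fst) .snd).to₂
  have hpred : Primrec fun a => g a - 1 := nat_sub.comp hg (.const 1)
  have h1 : PrimrecPred fun a => ∀ t < 2 * g a,
      (v a t).2 < 2 ^ digits (max (v a t).1 (v a (t + 1)).1) :=
    PrimrecRel.forall_below (nat_lt.comp (snd.comp (hv.comp .fst .snd))
      (nat_pow.comp (.const 2) (primrec_digits.comp (nat_max.comp (hv1 .fst .snd)
        (hv1 .fst (succ.comp .snd)))))) (nat_double.comp hg)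
  have h2 : PrimrecPred fun a => 0 < (v a (g a)).1 := nat_lt.comp (.const 0) (hv1 .id hg)
  have h3 : PrimrecPred fun a => ∀ x < (v a (g a)).1, ∑ t ∈ Finset.range 3,
      ∑ y ∈ Finset.range (v a (g a - 1 + t)).1,
        (if WAdj (v a) (g a, x) (g a - 1 + t, y) then 1 else 0) = k a := by
    refine PrimrecRel.forall_below (Primrec.eq.comp (sum_range (.const 3) ?_) (hk.comp .fst))
      (hv1 .id hg)
    have hj : Primrec fun c : (α × ℕ) × ℕ => g c.1.1 - 1 + c.2 :=
      nat_add.comp (hpred.comp (fst.comp .fst)) .snd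
    refine sum_range (hv1 (fst.comp .fst) hj) (ite (primrecPred_wadj
      (hvf (fst.comp (fst.comp .fst))) (z := fun c => (g c.1.1.1, c.1.1.2))
      (w := fun c => (g c.1.1.1 - 1 + c.1.2, c.2)) ?_ ?_) (.const 1) (.const 0)).to₂
    · exact (hg.comp (fst.comp (fst.comp .fst))).pair (snd.comp (fst.comp .fst))
    · exact (hj.comp .fst).pair .snd
  have h4 : PrimrecPred fun a => ∀ x < (v a (g a)).1, ∃ y < (v a (g a - 1)).1,
      Outer (v a (g a - 1)) y x :=
    PrimrecRel.forall_below (PrimrecRel.exists_below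
      (primrecPred_outer (hv.comp (fst.comp .fst) (hpred.comp (fst.comp .fst))) .snd
        (snd.comp .fst)) (hv1 .fst (hpred.comp .fst))) (hv1 .id hg)
  have h5 : PrimrecPred fun a => k a % 2 = 0 → (∑ x ∈ Finset.range (v a (g a)).1,
      ∑ y ∈ Finset.range (v a (g a + 1)).1, (if Outer (v a (g a)) x y then 1 else 0)) % 2 = 0 :=
    PrimrecPred.imp (Primrec.eq.comp (nat_mod.comp hk (.const 2)) (.const 0))
      (Primrec.eq.comp (nat_mod.comp (sum_range (hv1 .id hg)
        (sum_range (hv1 .fst (succ.comp (hg.comp .fst))) (ite (primrecPred_outer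
          (hv.comp (fst.comp .fst) (hg.comp (fst.comp .fst))) (snd.comp .fst) .snd)
          (.const 1) (.const 0)).to₂).to₂) (.const 2)) (.const 0))
  have h6 : PrimrecPred fun a => ∀ l ∈ listsUpTo (windowVertices (g a) (v a)) (g a),
      3 ≤ l.length → l.length < g a → l.Nodup →
      ¬ ∀ i < l.length, WAdj (v a) (l.getD i (0, 0)) (l.getD ((i + 1) % l.length) (0, 0)) := by
    refine PrimrecRel.forall_mem (PrimrecPred.imp ?_ (PrimrecPred.imp ?_ (PrimrecPred.imp ?_
      (PrimrecPred.not ?_)))) (Primrec.listsUpTo.comp ?_ hg)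
    · exact nat_le.comp (.const 3) (list_length.comp .snd)
    · exact nat_lt.comp (list_length.comp .snd) (hg.comp .fst)
    · simp only [nodup_iff_getD]
      refine PrimrecRel.forall_below (PrimrecRel.forall_below (PrimrecPred.not
        (Primrec.eq.comp ((list_getD _).comp (snd.comp (fst.comp .fst)) (snd.comp .fst))
          ((list_getD _).comp (snd.comp (fst.comp .fst)) .snd))) .snd) (list_length.comp .snd)
    · exact PrimrecRel.forall_below (primrecPred_wadj (hvf (fst.comp .fst))
        ((list_getD _).comp (snd.comp .fst) .snd)
        ((list_getD _).comp (snd.comp .fst) (nat_mod.comp (succ.comp .snd)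
          (list_length.comp (snd.comp .fst))))) (list_length.comp .snd)
    · exact list_flatMap (list_range.comp (succ.comp (nat_double.comp hg)))
        (list_map (list_range.comp (hv1 .fst .snd)) ((snd.comp .fst).pair .snd).to₂).to₂
  exact (h1.and (h2.and (h3.and (h4.and (h5.and h6))))).of_eq fun a => window_iff.symm

theorem primrec_cyc : Primrec₂ (cyc : List (ℕ × ℕ) → ℕ → ℕ × ℕ) :=
  (list_getD _).comp .fst (nat_mod.comp .snd (list_length.comp .fst))

theorem primrecPred_closed {k g : α → ℕ} {u : α → List (ℕ × ℕ)} (hk : Primrec k) (hg : Primrec g)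
    (hu : Primrec u) : PrimrecPred fun a => Closed (Window (k a) (g a)) (u a) := by
  have h1 : PrimrecPred fun a => u a ≠ [] ∧ ∀ i < (u a).length,
      Window (k a) (g a) fun t => cyc (u a) (i + t) :=
    (Primrec.eq.comp hu (.const [])).not.and (PrimrecRel.forall_below
      (primrecPred_window (hk.comp .fst) (hg.comp .fst)
        (primrec_cyc.comp (hu.comp (fst.comp .fst)) (nat_add.comp (snd.comp .fst) .snd)).to₂)
      (list_length.comp hu))
  refine h1.of_eq fun a => and_congr_right fun hne => ⟨fun h i => ?_, fun h i _ => h i⟩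
  have := h _ (Nat.mod_lt i (List.length_pos_of_ne_nil hne))
  simpa only [cyc_mod_add] using this

theorem primrec_weight : Primrec (weight Prod.fst : List (ℕ × ℕ) → ℕ) :=
  (list_foldr .id (.const 0) (h := fun _ p => p.1.1 + p.2)
    (nat_add.comp (fst.comp (fst.comp .snd)) (snd.comp .snd)).to₂).of_eq fun u => by
    induction u with
    | nil => rfl
    | cons z u ih =>
      simp only [id_eq] at ih
      simp [weight, ih]

end Primrec

/-- The bound on the sizes of layers that are considered light. -/
def sizeBound (g m : ℕ) : ℕ := 2 * m * (2 * g + 1)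

/-- The bound on the lengths of the closed words to which a closed word of weight `m` has to be
compared. -/
def lengthBound (g m : ℕ) : ℕ := (2 * g + 1) * (2 * (letters (sizeBound g m)).card ^ (2 * g))

/-- All letters that may occur in layer sizes up to `b`, as a list. -/
def letterList (b : ℕ) : List (ℕ × ℕ) :=
  (List.range (b + 1)).flatMap fun a => (List.range (2 ^ digits b)).map fun e => (a, e)

theorem mem_letterList {b : ℕ} {z : ℕ × ℕ} :
    z ∈ letterList b ↔ z.1 ≤ b ∧ z.2 < 2 ^ digits b := by
  obtain ⟨i, x⟩ := z
  simp [letterList]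

/-- A closed word of least mean weight among the closed words up to a certain length and weight. -/
def IsOptimal (k g : ℕ) (u : List (ℕ × ℕ)) : Prop :=
  Closed (Window k g) u ∧ ∀ u' ∈ listsUpTo
    (letterList (weight Prod.fst u * lengthBound g (weight Prod.fst u)))
    (lengthBound g (weight Prod.fst u)), Closed (Window k g) u' →
      weight Prod.fst u * u'.length ≤ u.length * weight Prod.fst u'

theorem exists_isOptimal {k g : ℕ} (hk : 3 ≤ k) (hg : 3 ≤ g) : ∃ u, IsOptimal k g u := by
  obtain ⟨u, hu, hmin⟩ := exists_minimal_mean (wt := Prod.fst) (Window.congr (by omega))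
    (exists_letters k g) (GirthGraph.exists_closed_window hk hg)
  exact ⟨u, hu, fun u' _ hu' => (hmin u' hu').trans_eq (mul_comm _ _)⟩

/-- The finite comparison in `IsOptimal` suffices for `mul_le_of_closed` with `A = m`, the weight of
`u`: a closed word of length at most `N` is either so heavy, of weight at least `m * N`, that the
inequality is trivial, or has layers of size at most `m * N` and was compared. -/
theorem IsOptimal.mul_le {k g : ℕ} (hg : 1 ≤ g) {u : List (ℕ × ℕ)} (hu : IsOptimal k g u) :
    ∀ d s, Legal (Window k g) (2 * g) s d → weight Prod.fst u * d ≤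
      u.length * ∑ i ∈ Finset.range d, (s i).1 +
        weight Prod.fst u * lengthBound g (weight Prod.fst u) := by
  have hlen := List.length_pos_of_ne_nil hu.1.1
  refine mul_le_of_closed (wt := Prod.fst) (A := weight Prod.fst u) (Window.congr hg)
    (F := letters (sizeBound g (weight Prod.fst u))) (fun v hv hs t ht => hv.mem_letters hs t ht)
    (by rw [card_letters]; positivity) rfl (Nat.le_mul_of_pos_right _ hlen) fun u' hu' hl => ?_
  set m := weight Prod.fst u
  set N := lengthBound g m
  rcases le_total (m * N) (weight Prod.fst u') with h | h
  · exact ((Nat.mul_le_mul_left _ hl).trans h).trans (Nat.le_mul_of_pos_left _ hlen)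
  · refine hu.2 u' (mem_listsUpTo.2 ⟨hl, fun z hz => mem_letterList.2 ?_⟩) hu'
    have hle (z : ℕ × ℕ) (hz : z ∈ u') : z.1 ≤ m * N :=
      (List.single_le_sum (fun _ _ => Nat.zero_le _) _ (List.mem_map_of_mem hz)).trans h
    obtain ⟨i, hi, rfl⟩ := List.getElem_of_mem hz
    refine ⟨hle _ hz, ?_⟩
    have h1 := (hu'.2 i).bounded 0 (by omega)
    simp only [add_zero, zero_add] at h1
    rw [cyc_of_lt u' hi] at h1
    refine h1.trans_le (Nat.pow_le_pow_right (by norm_num) (digits_mono (max_le (hle _ hz) ?_)))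
    exact hle _ (cyc_mem hu'.1 _)

theorem primrec_lengthBound : Primrec₂ lengthBound := by
  have hg : Primrec fun p : ℕ × ℕ => 2 * p.1 := nat_double.comp .fst
  have hB : Primrec fun p : ℕ × ℕ => sizeBound p.1 p.2 :=
    nat_mul.comp (nat_double.comp .snd) (succ.comp hg)
  have hF : Primrec fun p : ℕ × ℕ => (letters (sizeBound p.1 p.2)).card :=
    (nat_mul.comp (succ.comp hB) (nat_pow.comp (.const 2) (primrec_digits.comp hB))).of_eq
      fun p => (card_letters _).symm
  exact nat_mul.comp (succ.comp hg) (nat_double.comp (nat_pow.comp hF hg))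

theorem primrec_letterList : Primrec letterList :=
  list_flatMap (list_range.comp succ) (list_map (list_range.comp (nat_pow.comp (.const 2)
    (primrec_digits.comp .fst))) ((snd.comp .fst).pair .snd).to₂).to₂

theorem primrecPred_isOptimal :
    PrimrecPred fun a : (ℕ × ℕ) × List (ℕ × ℕ) => IsOptimal a.1.1 a.1.2 a.2 := by
  have hk : Primrec fun a : (ℕ × ℕ) × List (ℕ × ℕ) => a.1.1 := fst.comp .fst
  have hg : Primrec fun a : (ℕ × ℕ) × List (ℕ × ℕ) => a.1.2 := snd.comp .fst
  have hm : Primrec fun a : (ℕ × ℕ) × List (ℕ × ℕ) => weight Prod.fst a.2 :=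
    primrec_weight.comp .snd
  have hN : Primrec fun a : (ℕ × ℕ) × List (ℕ × ℕ) => lengthBound a.1.2 (weight Prod.fst a.2) :=
    primrec_lengthBound.comp hg hm
  exact (primrecPred_closed hk hg .snd).and (PrimrecRel.forall_mem (PrimrecPred.imp
    (primrecPred_closed (hk.comp .fst) (hg.comp .fst) .snd)
    (nat_le.comp (nat_mul.comp (hm.comp .fst) (list_length.comp .snd))
      (nat_mul.comp (list_length.comp (snd.comp .fst)) (primrec_weight.comp .snd))))
    (Primrec.listsUpTo.comp (primrec_letterList.comp (nat_mul.comp hm hN)) hN))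

/-- Weight and length of an optimal closed word are computed by search. -/
theorem exists_partrec : ∃ p q : ℕ → ℕ →. ℕ, Partrec₂ p ∧ Partrec₂ q ∧ ∀ k g, 3 ≤ k → 3 ≤ g →
    ∃ u, IsOptimal k g u ∧ weight Prod.fst u ∈ p k g ∧ u.length ∈ q k g := by
  obtain ⟨t, ht, hopt⟩ : ∃ t : (ℕ × ℕ) × List (ℕ × ℕ) → Bool, Primrec t ∧
      ∀ k g u, t ((k, g), u) = true ↔ IsOptimal k g u := by
    obtain ⟨_, h⟩ := primrecPred_isOptimal
    exact ⟨_, h, fun k g u => decide_eq_true_iff⟩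
  -- The default `[]` is harmless, since it is not closed and fails the test.
  let word (n : ℕ) : List (ℕ × ℕ) := (Encodable.decode n).getD []
  have hword : Primrec word := option_getD.comp Primrec.decode (.const [])
  let test (a : ℕ × ℕ) (n : ℕ) : Bool := t (a, word n)
  have htest : Primrec₂ test := ht.comp (Primrec.pair .fst (hword.comp .snd))
  have hsearch : Partrec fun a => Nat.rfind fun n => Part.some (test a n) :=
    Partrec.rfind htest.to_comp.partrec
  -- Both functions run the same search, so weight and length belong to the same word.
  refine ⟨fun k g => (Nat.rfind fun n => Part.some (test (k, g) n)).map
      fun n => weight Prod.fst (word n),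
    fun k g => (Nat.rfind fun n => Part.some (test (k, g) n)).map fun n => (word n).length,
    hsearch.map (primrec_weight.comp (hword.comp .snd)).to₂.to_comp,
    hsearch.map (list_length.comp (hword.comp .snd)).to₂.to_comp, fun k g hk hg => ?_⟩
  obtain ⟨u, hu⟩ := exists_isOptimal hk hg
  have hdom : (Nat.rfind fun n => Part.some (test (k, g) n)).Dom := by
    refine Nat.rfind_dom.2 ⟨Encodable.encode u, Part.mem_some_iff.2 ?_, fun _ => trivial⟩
    have h1 : word (Encodable.encode u) = u := by simp [word]
    simp only [test, h1]
    exact ((hopt k g u).2 hu).symm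
  obtain ⟨n, hn⟩ := Part.dom_iff_mem.1 hdom
  have h1 := Part.mem_some_iff.1 (Nat.rfind_spec hn)
  exact ⟨word n, (hopt k g _).1 h1.symm, Part.mem_map _ hn, Part.mem_map _ hn⟩

end LayerWord

/-! ### The rate is the mean weight of an optimal word, and the theorem -/

open LayerWord SlidingWord GirthGraph in
theorem LayerWord.IsOptimal.isLeast {k g : ℕ} (hk : 3 ≤ k) (hg : 3 ≤ g) {u : List (ℕ × ℕ)}
    (hu : IsOptimal k g u) :
    IsLeast (linearRates k g) ((weight Prod.fst u : ℝ) / (u.length : ℝ)) := by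
  have hlin := hu.mul_le (by omega)
  set m := weight Prod.fst u
  set C := m * lengthBound g m
  have hp : (0 : ℝ) < u.length := by exact_mod_cast List.length_pos_of_ne_nil hu.1.1
  obtain ⟨C', d₀, hup⟩ := exists_mem_girthDiamOrders_le hk hg hu.1 hlin
  refine ⟨⟨C' / u.length, eventually_atTop.2 ⟨d₀, fun d hd => ?_⟩⟩, fun c ⟨C₁, hc⟩ => ?_⟩
  · obtain ⟨n, hn, hle⟩ := hup d hd
    refine ⟨⟨n, hn⟩, ?_⟩
    have h1 : (girthDiamCageOrder k g d : ℝ) ≤ n := by exact_mod_cast Nat.sInf_le hn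
    have h2 : (u.length : ℝ) * n ≤ m * d + C' := by exact_mod_cast hle
    refine h1.trans ?_
    rw [div_mul_eq_mul_div, ← add_div, le_div_iff₀ hp]
    linarith
  · by_contra! hlt
    rw [lt_div_iff₀ hp] at hlt
    obtain ⟨d₁, hd₁⟩ := eventually_atTop.1 hc
    obtain ⟨d₂, hd₂⟩ := exists_nat_gt ((u.length * C₁ + C) / (m - c * u.length))
    obtain ⟨hne, hle⟩ := hd₁ (max d₁ d₂) (le_max_left _ _)
    -- For a smaller rate `c`, the lower bound fails once `d * (m - c * u.length)` exceeds the
    -- constants; `d₂` is chosen accordingly.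
    have h1 := mul_le_of_mem_girthDiamOrders (by omega) hlin (Nat.sInf_mem hne)
    have h2 : (m : ℝ) * (max d₁ d₂ : ℕ) ≤ u.length * girthDiamCageOrder k g (max d₁ d₂) + C := by
      exact_mod_cast h1
    have h3 : ((u.length * C₁ + C) / (m - c * u.length) : ℝ) < (max d₁ d₂ : ℕ) :=
      hd₂.trans_le (by exact_mod_cast le_max_right _ _)
    rw [div_lt_iff₀ (by linarith)] at h3
    have h4 := mul_le_mul_of_nonneg_left hle hp.le
    linarith

theorem theorem2 :
    ∃ (M : TM2ComputableAux PartrecToTM2.Γ' PartrecToTM2.Γ') (T : ℕ → ℕ → ℕ),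
      (∀ i : M.tm.K, Finite (M.tm.Γ i)) ∧
      ∀ k g : ℕ, 3 ≤ k → 3 ≤ g →
        IsLeast (linearRates k g) (girthDiamRate k g) ∧
        ∃ p q : ℕ, 0 < q ∧ girthDiamRate k g = (p : ℝ) / (q : ℝ) ∧
          OutputsPairWithin M k g p q (T k g) := by
  obtain ⟨p, q, hp, hq, h⟩ := LayerWord.exists_partrec
  obtain ⟨M, hfin, hM⟩ := CodeTM.exists_machine hp hq
  -- The machine is fixed before `k` and `g`; only the time bound is chosen for each pair, with the
  -- irrelevant value 0 outside the range.
  have key (k g : ℕ) : ∃ t, 3 ≤ k → 3 ≤ g →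
      IsLeast (linearRates k g) (girthDiamRate k g) ∧
        ∃ p q : ℕ, 0 < q ∧ girthDiamRate k g = (p : ℝ) / (q : ℝ) ∧
          OutputsPairWithin M k g p q t := by
    by_cases hkg : 3 ≤ k ∧ 3 ≤ g
    · obtain ⟨u, hu, hpu, hqu⟩ := h k g hkg.1 hkg.2
      obtain ⟨t, ht⟩ := hM k g _ _ hpu hqu
      have hleast := hu.isLeast hkg.1 hkg.2
      have heq : girthDiamRate k g = _ := hleast.csInf_eq
      exact ⟨t, fun _ _ => ⟨heq ▸ hleast, _, _, List.length_pos_of_ne_nil hu.1.1, heq, ht⟩⟩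
    · exact ⟨0, fun hk hg => absurd ⟨hk, hg⟩ hkg⟩
  choose T hT using key
  exact ⟨M, T, hfin, hT⟩
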